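/- Let $\Bbbk$ be an algebraically closed field of characteristic zero and let $H$ be a finite-dimensional pointed Hopf algebra over $\Bbbk$ with group of grouplike elements $G=G(H)$, not necessarily abelian. Let $H_0\subseteq H_1\subseteq\cdots$ be the coradical filtration of $H$ and suppose that $H$ has rank one, that is, $H_0$ is a Hopf subalgebra, $H$ is generated by $H_1$ as an algebra, and $\dim_\Bbbk(\Bbbk\otimes_{H_0}H_1)=2$. An action of a Hopf algebra $K$ on a field $L\supseteq\Bbbk$ is a left $K$-module structure on $L$, compatible with the $\Bbbk$-vector space structure of $L$, such that $h\cdot(ab)=\sum(h_1\cdot a)(h_2\cdot b)$ and $h\cdot 1=\varepsilon(h)1$; it is inner faithful if no nonzero Hopf ideal of $K$ annihilates $L$; and $L^K=\{\ell\in L : h\cdot\ell=\varepsilon(h)\ell \text{ for all } h\in K\}$. A Hopf algebra is Galois-theoretical if it acts inner faithfully on some field containing $\Bbbk$. For $n\ge 2$ and a primitive $n$-th root of unity $\zeta\in\Bbbk$, the Taft algebra $T(n,\zeta)$ is generated by a grouplike element $g$ and an element $x$ with $\Delta(x)=g\otimes x+x\otimes 1$, subject to $g^n=1$, $x^n=0$,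 $gx=\zeta xg$. Then $H$ is generated as an algebra by $G$ and an element $x$ with $\Delta(x)=g\otimes x+x\otimes 1$, for some $g$ in the center of $G$. For every such pair $(g,x)$, with $H'$ the Hopf subalgebra of $H$ generated by $\{g,x\}$, the following hold. (a) $H$ is Galois-theoretical if and only if $H'$ is a Taft algebra $T(n,\zeta)$ for some $n$ and $\zeta$. In this case, if $H$ acts inner faithfully on a field $L\supseteq\Bbbk$, then (i) $L^H=L^G$ is a subfield $F$ of $L$ and $L$ is a Galois extension of $F$; (ii) $L^{H'}=L^{\langle g\rangle}$ is a subfield $E$ of $L$ with $F\subseteq E$, and $L$ is a cyclic Galois extension of $E$ of degree $n$. (b) Suppose that $H'$ is a Taft algebra. If $L\supseteq\Bbbk$ is any field with a faithful action of $G$ by $\Bbbk$-algebra automorphisms, then this $G$-action extends to an inner faithful action of $H$ on $L$ such that $x$ acts by a nonzero operator. -/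

import Mathlib

universe u v w

open scoped TensorProduct

namespace PointedHopf

section Coalgebra

variable (k : Type u) [Field k] {C : Type v} [AddCommGroup C] [Module k C] [Coalgebra k C]

/-- `D` is a subcoalgebra of `C`: `Δ(D) ⊆ D ⊗ D`. -/
def IsSubcoalgebra (D : Submodule k C) : Prop :=
  ∀ c ∈ D, Coalgebra.comul (R := k) c ∈ LinearMap.range (TensorProduct.map D.subtype D.subtype)

/-- A simple subcoalgebra: nonzero, with no subcoalgebras except `0` and itself. -/
structure IsSimpleSubcoalgebra (D : Submodule k C) : Prop where
  isSubcoalgebra : IsSubcoalgebra k D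
  ne_bot : D ≠ ⊥
  eq_bot_or_eq : ∀ E : Submodule k C, IsSubcoalgebra k E → E ≤ D → E = ⊥ ∨ E = D

variable (C) in
/-- `C` is pointed: all of its simple subcoalgebras are one-dimensional. -/
def IsPointed : Prop :=
  ∀ D : Submodule k C, IsSimpleSubcoalgebra k D → Module.finrank k D = 1

variable (C) in
/-- The coradical filtration: `C₀` is the sum of all simple subcoalgebras, and
`Cₙ₊₁ = Δ⁻¹(C ⊗ Cₙ + C₀ ⊗ C)`. -/
def coradicalFiltration : ℕ → Submodule k C
  | 0 => sSup {D | IsSimpleSubcoalgebra k D}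
  | n + 1 => Submodule.comap (Coalgebra.comul (R := k) (A := C))
      (LinearMap.range (LinearMap.lTensor C (coradicalFiltration n).subtype) ⊔
        LinearMap.range (LinearMap.rTensor C
          (sSup {D : Submodule k C | IsSimpleSubcoalgebra k D}).subtype))

end Coalgebra

section Hopf

variable (k : Type u) [Field k] (H : Type v) [Ring H] [HopfAlgebra k H]

/-- The subspace `D` is a Hopf subalgebra of `H`. -/
structure IsHopfSubalgebra (D : Submodule k H) : Prop where
  one_mem : (1 : H) ∈ D
  mul_mem : ∀ a ∈ D, ∀ b ∈ D, a * b ∈ D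
  isSubcoalgebra : IsSubcoalgebra k D
  antipode_mem : ∀ a ∈ D, HopfAlgebra.antipode k a ∈ D

/-- The relations `a h - ε(a) h`, `a ∈ H₀`, `h ∈ H₁`, inside `H₁`. The quotient of `H₁` by them is
the tensor product `k ⊗_{H₀} H₁`, where `H₀` acts on `k` (from the right) by the counit and on `H₁`
by left multiplication. -/
def rankRelations : Submodule k (coradicalFiltration k H 1) :=
  Submodule.span k
    {y | ∃ a ∈ coradicalFiltration k H 0, ∃ h : coradicalFiltration k H 1,
      (y : H) = a * (h : H) - Coalgebra.counit (R := k) a • (h : H)}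

/-- `H` has rank `θ`: the coradical `H₀` is a Hopf subalgebra, `H` is generated by `H₁` as an
algebra, and `dim (k ⊗_{H₀} H₁) = θ + 1`. -/
structure HasRank (θ : ℕ) : Prop where
  isHopfSubalgebra : IsHopfSubalgebra k H (coradicalFiltration k H 0)
  adjoin_eq_top : Algebra.adjoin k (coradicalFiltration k H 1 : Set H) = ⊤
  finrank_eq : Module.finrank k (coradicalFiltration k H 1 ⧸ rankRelations k H) = θ + 1

variable {H} in
/-- `x` is `(g, g')`-skew-primitive: `g`, `g'` are grouplike and `Δ(x) = g ⊗ x + x ⊗ g'`. -/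
structure IsSkewPrimitive (g g' x : H) : Prop where
  left : IsGroupLikeElem k g
  right : IsGroupLikeElem k g'
  comul_eq : Coalgebra.comul (R := k) x = g ⊗ₜ[k] x + x ⊗ₜ[k] g'

variable {H} in
/-- `g` is a central element of the group `G(H)`, `x` is a `(g, 1)`-skew-primitive element, and
`H` is generated by `G(H)` and `x` as an algebra. -/
structure IsGeneratingPair (g : GroupLike k H) (x : H) : Prop where
  mem_center : g ∈ Subgroup.center (GroupLike k H)
  isSkewPrimitive : IsSkewPrimitive k g.val 1 x
  adjoin_eq_top : Algebra.adjoin k (insert x {a : H | IsGroupLikeElem k a}) = ⊤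

end Hopf

section Taft

/-- Names of the two generators of a Taft algebra. -/
inductive TaftGen : Type
  | g : TaftGen
  | x : TaftGen

variable (k : Type u) [Field k]

/-- The relations `gⁿ = 1`, `xⁿ = 0`, `g x = ζ x g`. -/
inductive TaftRel (n : ℕ) (ζ : k) : FreeAlgebra k TaftGen → FreeAlgebra k TaftGen → Prop
  | g_pow : TaftRel n ζ (FreeAlgebra.ι k TaftGen.g ^ n) 1
  | x_pow : TaftRel n ζ (FreeAlgebra.ι k TaftGen.x ^ n) 0
  | g_mul_x : TaftRel n ζ (FreeAlgebra.ι k TaftGen.g * FreeAlgebra.ι k TaftGen.x)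
      (ζ • (FreeAlgebra.ι k TaftGen.x * FreeAlgebra.ι k TaftGen.g))

/-- The algebra `T(n, ζ)` generated by `g`, `x` subject to `gⁿ = 1`, `xⁿ = 0`, `g x = ζ x g`. -/
abbrev TaftAlgebra (n : ℕ) (ζ : k) : Type u := RingQuot (TaftRel k n ζ)

variable {k}

/-- The image in `T(n, ζ)` of a generator. -/
noncomputable def TaftAlgebra.gen (n : ℕ) (ζ : k) (t : TaftGen) : TaftAlgebra k n ζ :=
  RingQuot.mkAlgHom k (TaftRel k n ζ) (FreeAlgebra.ι k t)

/-- The subalgebra `A` of `H` is (for the structure maps of `H`) a Taft algebra `T(n, ζ)`, where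
`n ≥ 2` and `ζ` is a primitive `n`-th root of unity. The Hopf structure of `T(n, ζ)` is the one for
which `g` is grouplike and `x` is `(g, 1)`-skew-primitive; as `g` and `x` generate, an isomorphism
of algebras respects it as soon as it does so on `g` and `x`. -/
structure IsTaft {H : Type v} [Ring H] [HopfAlgebra k H] (A : Subalgebra k H) (n : ℕ) (ζ : k) :
    Prop where
  two_le : 2 ≤ n
  isPrimitiveRoot : IsPrimitiveRoot ζ n
  exists_equiv : ∃ e : TaftAlgebra k n ζ ≃ₐ[k] A,
    IsSkewPrimitive k (e (TaftAlgebra.gen n ζ TaftGen.g) : H) 1 (e (TaftAlgebra.gen n ζ TaftGen.x))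

end Taft

section Action

/-- An action of the Hopf algebra `H` on the commutative `k`-algebra `A`: a (`k`-linear) left
`H`-module structure with `h · (a b) = ∑ (h₁ · a) (h₂ · b)` and `h · 1 = ε(h) 1`. -/
structure HopfAction (k : Type u) [Field k] (H : Type v) [Ring H] [HopfAlgebra k H]
    (A : Type w) [CommRing A] [Algebra k A] where
  toEnd : H →ₐ[k] Module.End k A
  map_mul : ∀ (h : H) (a b : A), toEnd h (a * b) =
    LinearMap.mul' k A (TensorProduct.map (toEnd.toLinearMap.flip a) (toEnd.toLinearMap.flip b)
      (Coalgebra.comul (R := k) h))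
  map_one : ∀ h : H, toEnd h 1 = algebraMap k A (Coalgebra.counit (R := k) h)

namespace HopfAction

variable {k : Type u} [Field k] {H : Type v} [Ring H] [HopfAlgebra k H]
  {A : Type w} [CommRing A] [Algebra k A] (ρ : HopfAction k H A)

/-- No nonzero Hopf ideal of `H` annihilates `A`. -/
def IsInnerFaithful : Prop :=
  ∀ I : Ideal H, I.IsTwoSided → I.IsHopfIdeal k → (∀ h ∈ I, ∀ a : A, ρ.toEnd h a = 0) → I = ⊥

/-- The invariants `{a | h · a = ε(h) a for all h ∈ B}` of a subalgebra `B` of `H`. -/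
def invariants (B : Subalgebra k H) : Set A :=
  {a | ∀ h ∈ B, ρ.toEnd h a = Coalgebra.counit (R := k) h • a}

/-- The elements of `A` fixed by a subgroup `K` of `G(H)`. -/
def fixedPoints (K : Subgroup (GroupLike k H)) : Set A :=
  {a | ∀ t ∈ K, ρ.toEnd t.val a = a}

end HopfAction

/-- `H` is Galois-theoretical: it acts inner faithfully on a field containing `k`. -/
def IsGaloisTheoretical (k : Type u) [Field k] (H : Type v) [Ring H] [HopfAlgebra k H] : Prop :=
  ∃ (L : Type (max u w)) (_ : Field L) (_ : Algebra k L) (ρ : HopfAction k H L), ρ.IsInnerFaithful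

end Action

end PointedHopf

open PointedHopf

/-!
Let `H` be pointed of rank one, with group of grouplikes `G` and group algebra `kG`.

*Structure of `H`.* Pointedness makes `kG` the coradical, and the Taft–Wilson theorem
(`mem_coradicalFiltration_one_decomp`) writes `H₁` as `kG` plus skew-primitive elements.
Multiplication by `∑ a`, `a ∈ G`, kills the relations defining `k ⊗_{H₀} H₁` but not the
skew-primitive elements, so dimension two means that modulo `kG` there is exactly one of them up to
scalars and right multiplication by `G` (`HasRank.groupLike_eq`, `HasRank.exists_eq_smul_add`).
Hence its grouplike `g` is central, and it generates `H` together with `G`. After adding a multiple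
of `g - 1` it becomes an element `y` with `g y = ζ y g`, where `ζ` is a primitive `n`-th root of
unity, `n ≥ 2` (`HasRank.exists_isEigenPair`), and then `G` acts on `y` by a character `χ`.

*Independence.* For a functional `f` that is `0` on each `a ∈ G` and `1` on each `y a`, the
operator `(f ⊗ id) ∘ Δ` acts on the elements `yⁱ a` as a `ζ`-derivative in `y`, up to terms of
lower degree. It lowers the degree to zero through the nonzero `ζ`-integers below `n`, which
proves that the `yⁱ a` with `i < n` are independent; if `f` moreover kills a coideal, they are
independent modulo that coideal (`IsSkewPrimitive.coeff_eq_zero`). The first version gives bases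
of `H` and of Taft algebras and rules out `ζ = 1`; the second one detects inner faithfulness on
skew-primitive elements.

*Actions.* A skew-primitive element generates a Hopf ideal, so if nonzero it acts by a nonzero
operator in an inner faithful action. On a field, commutativity forces `y` to act by `v (1 - g)`
with `g v = ζ v`, so that `yⁿ` acts by `vⁿ (1 - gⁿ)`. By the `q`-binomial theorem `yⁿ` is
skew-primitive, hence a multiple of `gⁿ - 1`. If `gⁿ ≠ 1`, then `vⁿ`, and so `v`, is a scalar,
contrary to `g v = ζ v`. This is the Taft relation `gⁿ = 1`, `yⁿ = 0`. Conversely, given the Taft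
relations and a faithful action of `G` on a field, Dedekind's theorem supplies a nonzero `v` with
`a v = χ(a) v` for all `a ∈ G`, and letting `y` act by `v (1 - g)` extends the action to `H`.
Finally `x` kills the elements fixed by `g`, so the invariants are fixed fields of finite groups
and Artin's theorem applies.
-/

namespace PointedHopf

/-! ### Contractions of the comultiplication -/

section Contraction

variable {k : Type u} [Field k] {C : Type v} [AddCommGroup C] [Module k C] [Coalgebra k C]

/-- The operator `(φ ⊗ id) ∘ Δ` on a coalgebra. -/
noncomputable def contractLeft (φ : C →ₗ[k] k) : C →ₗ[k] C :=
  (TensorProduct.lid k C).toLinearMap ∘ₗ φ.rTensor C ∘ₗ Coalgebra.comul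

/-- The operator `(id ⊗ φ) ∘ Δ` on a coalgebra. -/
noncomputable def contractRight (φ : C →ₗ[k] k) : C →ₗ[k] C :=
  (TensorProduct.rid k C).toLinearMap ∘ₗ φ.lTensor C ∘ₗ Coalgebra.comul

lemma contractLeft_apply (φ : C →ₗ[k] k) (z : C) :
    contractLeft φ z = TensorProduct.lid k C (φ.rTensor C (Coalgebra.comul z)) := rfl

lemma contractRight_apply (φ : C →ₗ[k] k) (z : C) :
    contractRight φ z = TensorProduct.rid k C (φ.lTensor C (Coalgebra.comul z)) := rfl

lemma contractLeft_counit (z : C) : contractLeft (Coalgebra.counit (R := k)) z = z := by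
  simp [contractLeft_apply]

lemma contractRight_counit (z : C) : contractRight (Coalgebra.counit (R := k)) z = z := by
  simp [contractRight_apply]

/-- Coassociativity: `Δ ∘ (φ ⊗ id) ∘ Δ = ((φ ⊗ id) ∘ Δ ⊗ id) ∘ Δ`. -/
lemma comul_contractLeft (φ : C →ₗ[k] k) (z : C) :
    Coalgebra.comul (contractLeft φ z) = (contractLeft φ).rTensor C (Coalgebra.comul (R :=
        k) z) := by
  have h1 : ∀ T : (C ⊗[k] C) ⊗[k] C,
      ((TensorProduct.lid k C).toLinearMap ∘ₗ φ.rTensor C).rTensor C T =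
        TensorProduct.lid k (C ⊗[k] C) (φ.rTensor (C ⊗[k] C) (TensorProduct.assoc k C C C T)) := by
    intro T
    induction T with
    | zero => simp
    | add p q hp hq => simp only [map_add, hp, hq]
    | tmul p q =>
      induction p with
      | zero => simp
      | add p p' hp hq => simp only [map_add, hp, hq, TensorProduct.add_tmul]
      | tmul p p' => simp [TensorProduct.smul_tmul']
  have h2 : ∀ S : C ⊗[k] C,
      Coalgebra.comul (R := k) (TensorProduct.lid k C (φ.rTensor C S)) =
        TensorProduct.lid k (C ⊗[k] C) (φ.rTensor (C ⊗[k] C)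
          (LinearMap.lTensor C Coalgebra.comul S)) := by
    intro S
    induction S with
    | zero => simp
    | add p q hp hq => simp only [map_add, hp, hq]
    | tmul p q => simp
  rw [contractLeft_apply, h2, ← Coalgebra.coassoc_apply, ← h1]
  rw [← LinearMap.comp_apply, ← LinearMap.rTensor_comp]
  rfl

lemma comul_contractRight (φ : C →ₗ[k] k) (z : C) :
    Coalgebra.comul (contractRight φ z) =
      (contractRight φ).lTensor C (Coalgebra.comul (R := k) z) := by
  have h1 : ∀ T : C ⊗[k] (C ⊗[k] C),
      ((TensorProduct.rid k C).toLinearMap ∘ₗ φ.lTensor C).lTensor C T =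
        TensorProduct.rid k (C ⊗[k] C)
          (φ.lTensor (C ⊗[k] C) ((TensorProduct.assoc k C C C).symm T)) := by
    intro T
    induction T with
    | zero => simp
    | add p q hp hq => simp only [map_add, hp, hq]
    | tmul p q =>
      induction q with
      | zero => simp
      | add p p' hp hq => simp only [map_add, hp, hq, TensorProduct.tmul_add]
      | tmul p p' => simp
  have h2 : ∀ S : C ⊗[k] C,
      Coalgebra.comul (R := k) (TensorProduct.rid k C (φ.lTensor C S)) =
        TensorProduct.rid k (C ⊗[k] C) (φ.lTensor (C ⊗[k] C)
          (LinearMap.rTensor C Coalgebra.comul S)) := by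
    intro S
    induction S with
    | zero => simp
    | add p q hp hq => simp only [map_add, hp, hq]
    | tmul p q => simp
  rw [contractRight_apply, h2, ← Coalgebra.coassoc_symm_apply, ← h1]
  rw [← LinearMap.comp_apply, ← LinearMap.lTensor_comp]
  rfl

lemma contractLeft_groupLike (φ : C →ₗ[k] k) (a : GroupLike k C) :
    contractLeft φ a.val = φ a.val • a.val := by
  simp [contractLeft_apply, a.2.comul_eq_tmul_self]

lemma contractRight_groupLike (φ : C →ₗ[k] k) (a : GroupLike k C) :
    contractRight φ a.val = φ a.val • a.val := by
  simp [contractRight_apply, a.2.comul_eq_tmul_self]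

end Contraction

lemma exists_dual_of_linearIndependent {k V ι : Type*} [Field k] [AddCommGroup V] [Module k V]
    {b : ι → V} (hb : LinearIndependent k b) (c : ι → k) : ∃ f : V →ₗ[k] k, ∀ i, f (b i) = c i := by
  obtain ⟨f, hf⟩ := LinearMap.exists_extend ((Module.Basis.span hb).constr k c)
  refine ⟨f, fun i => ?_⟩
  have h := congrArg (fun F => F (Module.Basis.span hb i)) hf
  rw [Module.Basis.constr_basis, LinearMap.comp_apply, Submodule.subtype_apply,
    Module.Basis.span_apply] at h
  exact h

/-! ### The coradical of a pointed coalgebra and the Taft–Wilson theorem -/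

section GroupSpan

variable (k : Type u) [Field k] (C : Type v) [AddCommGroup C] [Module k C] [Coalgebra k C]

/-- The span of the grouplike elements of a coalgebra. -/
def groupSpan : Submodule k C := Submodule.span k (Set.range (GroupLike.val (R := k) (A := C)))

variable {k C}

lemma groupLike_mem_groupSpan (a : GroupLike k C) : a.val ∈ groupSpan k C :=
  Submodule.subset_span ⟨a, rfl⟩

lemma mem_groupSpan_iff [Fintype (GroupLike k C)] {z : C} :
    z ∈ groupSpan k C ↔ ∃ c : GroupLike k C → k, ∑ a, c a • a.val = z :=
  Submodule.mem_span_range_iff_exists_fun k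

lemma finite_groupLike [FiniteDimensional k C] : Finite (GroupLike k C) :=
  (linearIndep_groupLikeVal (R := k) (A := C)).finite

lemma exists_dual_groupLike [DecidableEq (GroupLike k C)] (b : GroupLike k C) :
    ∃ f : C →ₗ[k] k, ∀ a : GroupLike k C, f a.val = if a = b then 1 else 0 :=
  exists_dual_of_linearIndependent linearIndep_groupLikeVal _

/-- A simple subcoalgebra of dimension one is spanned by a grouplike element. -/
lemma IsSimpleSubcoalgebra.le_groupSpan {D : Submodule k C} (hD : IsSimpleSubcoalgebra k D)
    (h1 : Module.finrank k D = 1) : D ≤ groupSpan k C := by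
  obtain ⟨d, hd, hspan⟩ := finrank_eq_one_iff'.1 h1
  have hmul : ∀ t : D ⊗[k] D, ∃ c : k,
      TensorProduct.map D.subtype D.subtype t = c • ((d : C) ⊗ₜ[k] (d : C)) := by
    intro t
    induction t with
    | zero => exact ⟨0, by simp⟩
    | add p q hp hq =>
      obtain ⟨a, ha⟩ := hp
      obtain ⟨b, hb⟩ := hq
      exact ⟨a + b, by rw [map_add, ha, hb, add_smul]⟩
    | tmul p q =>
      obtain ⟨a, rfl⟩ := hspan p
      obtain ⟨b, rfl⟩ := hspan q
      exact ⟨a * b, by simp [TensorProduct.smul_tmul', TensorProduct.tmul_smul, smul_smul,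
          mul_comm]⟩
  obtain ⟨t, ht⟩ := hD.isSubcoalgebra d d.2
  obtain ⟨c, hc⟩ := hmul t
  rw [ht] at hc
  have hε : (c * Coalgebra.counit (R := k) (d : C)) • (d : C) = d := by
    have := contractLeft_counit (k := k) (d : C)
    rwa [contractLeft_apply, hc, map_smul, map_smul, LinearMap.rTensor_tmul,
      TensorProduct.lid_tmul, smul_smul] at this
  have hd' : (d : C) ≠ 0 := by simpa using hd
  have hcε : c * Coalgebra.counit (R := k) (d : C) = 1 := by
    by_contra hne
    have : (c * Coalgebra.counit (R := k) (d : C) - 1) • (d : C) = 0 := by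
      rw [sub_smul, hε, one_smul, sub_self]
    exact (smul_ne_zero (sub_ne_zero.2 hne) hd') this
  have hgl : IsGroupLikeElem k (c • (d : C)) :=
    ⟨by simpa using hcε, by
      rw [map_smul, hc, TensorProduct.smul_tmul', TensorProduct.tmul_smul]⟩
  have hdmem : (d : C) ∈ groupSpan k C := by
    rw [← hε, mul_comm, mul_smul]
    exact Submodule.smul_mem _ _ (groupLike_mem_groupSpan ⟨_, hgl⟩)
  intro y hy
  obtain ⟨b, hb⟩ := hspan ⟨y, hy⟩
  have : y = b • (d : C) := by simpa using (congrArg Subtype.val hb).symm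
  rw [this]
  exact Submodule.smul_mem _ _ hdmem

lemma isSimpleSubcoalgebra_span_groupLike (a : GroupLike k C) :
    IsSimpleSubcoalgebra k (Submodule.span k {a.val}) := by
  have ha0 : a.val ≠ 0 := a.2.ne_zero
  refine ⟨?_, by simpa using ha0, ?_⟩
  · intro c hc
    obtain ⟨r, rfl⟩ := Submodule.mem_span_singleton.1 hc
    have hmem : a.val ∈ Submodule.span k {a.val} := Submodule.mem_span_singleton_self _
    refine ⟨r • (⟨a.val, hmem⟩ ⊗ₜ[k] ⟨a.val, hmem⟩), ?_⟩
    simp [a.2.comul_eq_tmul_self]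
  · intro E _ hE
    by_cases hb : E = ⊥
    · exact Or.inl hb
    · refine Or.inr (le_antisymm hE ?_)
      obtain ⟨y, hy, hy0⟩ := Submodule.exists_mem_ne_zero_of_ne_bot hb
      obtain ⟨r, rfl⟩ := Submodule.mem_span_singleton.1 (hE hy)
      have hr : r ≠ 0 := by rintro rfl; simp at hy0
      rw [Submodule.span_singleton_le_iff_mem]
      have := E.smul_mem r⁻¹ hy
      rwa [smul_smul, inv_mul_cancel₀ hr, one_smul] at this

/-- The coradical of a pointed coalgebra is spanned by the grouplike elements. -/
lemma coradicalFiltration_zero (hp : IsPointed k C) : coradicalFiltration k C 0 = groupSpan k C :=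
    by
  apply le_antisymm
  · exact sSup_le fun D hD => IsSimpleSubcoalgebra.le_groupSpan hD (hp D hD)
  · rw [groupSpan, Submodule.span_le]
    rintro _ ⟨a, rfl⟩
    have : Submodule.span k {a.val} ≤ coradicalFiltration k C 0 :=
      le_sSup (isSimpleSubcoalgebra_span_groupLike a)
    exact this (Submodule.mem_span_singleton_self _)

lemma mem_coradicalFiltration_one (hp : IsPointed k C) [Fintype (GroupLike k C)] {z : C} :
    z ∈ coradicalFiltration k C 1 ↔ ∃ u w : GroupLike k C → C,
      Coalgebra.comul (R := k) z = ∑ a, a.val ⊗ₜ[k] u a + ∑ a, w a ⊗ₜ[k] a.val := by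
  have h0 := coradicalFiltration_zero hp
  have h0' : sSup {D : Submodule k C | IsSimpleSubcoalgebra k D} = groupSpan k C := h0
  rw [coradicalFiltration, Submodule.mem_comap, h0, h0', Submodule.mem_sup]
  constructor
  · rintro ⟨_, ⟨s, rfl⟩, _, ⟨t, rfl⟩, hst⟩
    have hs : ∃ w : GroupLike k C → C,
        LinearMap.lTensor C (groupSpan k C).subtype s = ∑ a, w a ⊗ₜ[k] a.val := by
      clear hst
      induction s with
      | zero => exact ⟨0, by simp⟩
      | add p q hp hq =>
        obtain ⟨a, ha⟩ := hp
        obtain ⟨b, hb⟩ := hq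
        exact ⟨a + b, by simp [ha, hb, TensorProduct.add_tmul, Finset.sum_add_distrib]⟩
      | tmul p q =>
        obtain ⟨c, hc⟩ := mem_groupSpan_iff.1 q.2
        refine ⟨fun a => c a • p, ?_⟩
        rw [LinearMap.lTensor_tmul, Submodule.subtype_apply, ← hc, TensorProduct.tmul_sum]
        simp [TensorProduct.smul_tmul]
    have ht : ∃ u : GroupLike k C → C,
        LinearMap.rTensor C (groupSpan k C).subtype t = ∑ a, a.val ⊗ₜ[k] u a := by
      clear hst hs
      induction t with
      | zero => exact ⟨0, by simp⟩
      | add p q hp hq =>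
        obtain ⟨a, ha⟩ := hp
        obtain ⟨b, hb⟩ := hq
        exact ⟨a + b, by simp [ha, hb, TensorProduct.tmul_add, Finset.sum_add_distrib]⟩
      | tmul p q =>
        obtain ⟨c, hc⟩ := mem_groupSpan_iff.1 p.2
        refine ⟨fun a => c a • q, ?_⟩
        rw [LinearMap.rTensor_tmul, Submodule.subtype_apply, ← hc, TensorProduct.sum_tmul]
        simp [TensorProduct.smul_tmul]
    obtain ⟨w, hw⟩ := hs
    obtain ⟨u, hu⟩ := ht
    exact ⟨u, w, by rw [← hst, hw, hu, add_comm]⟩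
  · rintro ⟨u, w, h⟩
    refine ⟨∑ a, w a ⊗ₜ[k] a.val, ?_, ∑ a, a.val ⊗ₜ[k] u a, ?_, by rw [h, add_comm]⟩
    · exact Submodule.sum_mem _ fun a _ =>
        ⟨w a ⊗ₜ ⟨a.val, groupLike_mem_groupSpan a⟩, by simp⟩
    · exact Submodule.sum_mem _ fun a _ =>
        ⟨⟨a.val, groupLike_mem_groupSpan a⟩ ⊗ₜ u a, by simp⟩

/-- If `Δ(y) = a ⊗ u + w ⊗ b` with `a`, `b` grouplike, then `y - ε(y) a` is skew-primitive. -/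
lemma comul_sub_counit_smul {a b : GroupLike k C} {y u w : C}
    (h : Coalgebra.comul (R := k) y = a.val ⊗ₜ[k] u + w ⊗ₜ[k] b.val) :
    Coalgebra.comul (R := k) (y - Coalgebra.counit (R := k) y • a.val) =
      a.val ⊗ₜ[k] (y - Coalgebra.counit (R := k) y • a.val) +
        (y - Coalgebra.counit (R := k) y • a.val) ⊗ₜ[k] b.val := by
  have hl : u + Coalgebra.counit (R := k) w • b.val = y := by
    have := contractLeft_counit (k := k) y
    rw [contractLeft_apply, h] at this
    simpa using this
  have hr : Coalgebra.counit (R := k) u • a.val + w = y := by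
    have := contractRight_counit (k := k) y
    rw [contractRight_apply, h] at this
    simpa using this
  have hε : Coalgebra.counit (R := k) y =
      Coalgebra.counit (R := k) u + Coalgebra.counit (R := k) w := by
    rw [← hl]; simp
  generalize Coalgebra.counit (R := k) u = p at *
  generalize Coalgebra.counit (R := k) w = q at *
  obtain rfl : u = y - q • b.val := eq_sub_of_add_eq hl
  obtain rfl : w = y - p • a.val := eq_sub_of_add_eq' hr
  rw [map_sub, map_smul, h, a.2.comul_eq_tmul_self, hε]
  simp only [TensorProduct.tmul_sub, TensorProduct.sub_tmul, TensorProduct.tmul_smul,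
    ← TensorProduct.smul_tmul']
  module

/-- The Taft–Wilson theorem: modulo the span of the grouplikes, every element of the first term of
the coradical filtration of a pointed coalgebra is a sum of skew-primitive elements. -/
theorem mem_coradicalFiltration_one_decomp (hp : IsPointed k C) [Fintype (GroupLike k C)] {z : C}
    (hz : z ∈ coradicalFiltration k C 1) :
    ∃ y : GroupLike k C → GroupLike k C → C,
      (∀ a b, Coalgebra.comul (R := k) (y a b) = a.val ⊗ₜ[k] y a b + y a b ⊗ₜ[k] b.val) ∧
      z - ∑ a, ∑ b, y a b ∈ groupSpan k C := by
  classical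
  choose e he using exists_dual_groupLike (k := k) (C := C)
  obtain ⟨u, w, h⟩ := (mem_coradicalFiltration_one hp).1 hz
  have hL : ∀ a, Coalgebra.comul (R := k) (contractLeft (e a) z) =
      a.val ⊗ₜ[k] u a + ∑ b, contractLeft (e a) (w b) ⊗ₜ[k] b.val := by
    intro a
    rw [comul_contractLeft, h, map_add, map_sum, map_sum]
    congr 1
    simp [contractLeft_groupLike, he, ite_smul, TensorProduct.ite_tmul]
  have hRL : ∀ a b, Coalgebra.comul (R := k) (contractRight (e b) (contractLeft (e a) z)) =
      a.val ⊗ₜ[k] contractRight (e b) (u a) + contractLeft (e a) (w b) ⊗ₜ[k] b.val := by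
    intro a b
    rw [comul_contractRight, hL, map_add, map_sum]
    congr 1
    simp [contractRight_groupLike, he, ite_smul, TensorProduct.tmul_ite]
  refine ⟨_, fun a b => comul_sub_counit_smul (hRL a b), ?_⟩
  have hmem : ∀ (c : k) (a : GroupLike k C), c • a.val ∈ groupSpan k C := fun c a =>
    Submodule.smul_mem _ _ (groupLike_mem_groupSpan a)
  have h1 : ∀ a, contractLeft (e a) z - ∑ b, contractRight (e b) (contractLeft (e a) z) ∈
      groupSpan k C := by
    intro a
    have hy : contractLeft (e a) z =
        Coalgebra.counit (R := k) (u a) • a.val + ∑ b, contractLeft (e a) (w b) := by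
      conv_lhs => rw [← contractRight_counit (k := k) (contractLeft (e a) z),
        contractRight_apply, hL]
      simp
    have hR : ∀ b, contractRight (e b) (contractLeft (e a) z) =
        e b (u a) • a.val + contractLeft (e a) (w b) := by
      intro b
      rw [contractRight_apply, hL]
      simp [he]
    rw [Finset.sum_congr rfl fun b _ => hR b, Finset.sum_add_distrib]
    nth_rw 1 [hy]
    rw [add_sub_add_right_eq_sub]
    exact Submodule.sub_mem _ (hmem _ _) (Submodule.sum_mem _ fun b _ => hmem _ _)
  have h2 : z - ∑ a, contractLeft (e a) z ∈ groupSpan k C := by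
    have hy : z = ∑ a, u a + ∑ a, Coalgebra.counit (R := k) (w a) • a.val := by
      conv_lhs => rw [← contractLeft_counit (k := k) z, contractLeft_apply, h]
      simp
    have hR : ∀ b, contractLeft (e b) z = u b + ∑ a, e b (w a) • a.val := by
      intro b
      rw [contractLeft_apply, h]
      simp [he]
    rw [Finset.sum_congr rfl fun b _ => hR b, Finset.sum_add_distrib]
    nth_rw 1 [hy]
    rw [add_sub_add_left_eq_sub]
    exact Submodule.sub_mem _ (Submodule.sum_mem _ fun a _ => hmem _ _)
      (Submodule.sum_mem _ fun b _ => Submodule.sum_mem _ fun a _ => hmem _ _)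
  have h3 : z - ∑ a, ∑ b, contractRight (e b) (contractLeft (e a) z) ∈ groupSpan k C := by
    have := Submodule.add_mem _ h2 (Submodule.sum_mem _ fun a (_ : a ∈ Finset.univ) => h1 a)
    rw [Finset.sum_sub_distrib] at this
    simpa using this
  have h4 : ∑ a, ∑ b, Coalgebra.counit (R := k) (contractRight (e b) (contractLeft (e a) z)) • a.val
      ∈ groupSpan k C :=
    Submodule.sum_mem _ fun a _ => Submodule.sum_mem _ fun b _ => hmem _ _
  have := Submodule.add_mem _ h3 h4
  simpa only [Finset.sum_sub_distrib, sub_add] using this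

end GroupSpan

/-! ### Group algebra and skew-primitive elements -/

section HopfGroupSpan

variable {k : Type u} [Field k] {H : Type v} [Ring H] [HopfAlgebra k H]

lemma groupSpan_mul_mem {a b : H} (ha : a ∈ groupSpan k H) (hb : b ∈ groupSpan k H) :
    a * b ∈ groupSpan k H := by
  have h : groupSpan k H * groupSpan k H ≤ groupSpan k H := by
    rw [groupSpan, Submodule.span_mul_span, Submodule.span_le]
    rintro _ ⟨_, ⟨a, rfl⟩, _, ⟨b, rfl⟩, rfl⟩
    exact groupLike_mem_groupSpan (a * b)
  exact h (Submodule.mul_mem_mul ha hb)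

lemma one_mem_groupSpan : (1 : H) ∈ groupSpan k H :=
  groupLike_mem_groupSpan (1 : GroupLike k H)

lemma val_mul_val_inv (a : GroupLike k H) : a.val * (a⁻¹).val = 1 := by
  rw [← GroupLike.val_mul, mul_inv_cancel, GroupLike.val_one]

lemma val_inv_mul_val (a : GroupLike k H) : (a⁻¹).val * a.val = 1 := by
  rw [← GroupLike.val_mul, inv_mul_cancel, GroupLike.val_one]

lemma mul_groupLike_mem_groupSpan_iff (a : GroupLike k H) {y : H} :
    y * a.val ∈ groupSpan k H ↔ y ∈ groupSpan k H := by
  refine ⟨fun h => ?_, fun h => groupSpan_mul_mem h (groupLike_mem_groupSpan a)⟩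
  have := groupSpan_mul_mem h (groupLike_mem_groupSpan a⁻¹)
  rwa [mul_assoc, val_mul_val_inv, mul_one] at this

lemma groupLike_mul_mem_groupSpan_iff (a : GroupLike k H) {y : H} :
    a.val * y ∈ groupSpan k H ↔ y ∈ groupSpan k H := by
  refine ⟨fun h => ?_, fun h => groupSpan_mul_mem (groupLike_mem_groupSpan a) h⟩
  have := groupSpan_mul_mem (groupLike_mem_groupSpan a⁻¹) h
  rwa [← mul_assoc, val_inv_mul_val, one_mul] at this

lemma adjoin_le_groupSpan {s : Set H} (hs : s ⊆ groupSpan k H) {z : H}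
    (hz : z ∈ Algebra.adjoin k s) : z ∈ groupSpan k H := by
  induction hz using Algebra.adjoin_induction with
  | mem x hx => exact hs hx
  | algebraMap r =>
    rw [Algebra.algebraMap_eq_smul_one]
    exact Submodule.smul_mem _ _ one_mem_groupSpan
  | add x y _ _ hx hy => exact Submodule.add_mem _ hx hy
  | mul x y _ _ hx hy => exact groupSpan_mul_mem hx hy

namespace IsSkewPrimitive

lemma contractLeft_eq {g : GroupLike k H} {x : H} (hx : IsSkewPrimitive k g.val 1 x)
    (φ : H →ₗ[k] k) : contractLeft φ x = φ g.val • x + φ x • (1 : H) := by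
  simp [contractLeft_apply, hx.comul_eq]

lemma counit_eq_zero {g : GroupLike k H} {x : H} (hx : IsSkewPrimitive k g.val 1 x) :
    Coalgebra.counit (R := k) x = 0 := by
  have h := contractLeft_counit (k := k) x
  rw [hx.contractLeft_eq, g.2.counit_eq_one, one_smul, add_eq_left] at h
  have := congrArg (Coalgebra.counit (R := k)) h
  simpa using this

lemma add_smul {g : GroupLike k H} {x y : H} (hx : IsSkewPrimitive k g.val 1 x)
    (hy : IsSkewPrimitive k g.val 1 y) (β γ : k) : IsSkewPrimitive k g.val 1 (β • x + γ • y) := by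
  refine ⟨g.2, .one, ?_⟩
  rw [map_add, map_smul, map_smul, hx.comul_eq, hy.comul_eq]
  simp only [TensorProduct.tmul_add, TensorProduct.add_tmul, TensorProduct.tmul_smul,
    ← TensorProduct.smul_tmul']
  module

/-- `g - 1` is a skew-primitive element. -/
lemma sub_one (g : GroupLike k H) : IsSkewPrimitive k g.val 1 (g.val - 1) := by
  refine ⟨g.2, .one, ?_⟩
  rw [map_sub, g.2.comul_eq_tmul_self, Bialgebra.comul_one, Algebra.TensorProduct.one_def,
    TensorProduct.tmul_sub, TensorProduct.sub_tmul]
  abel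

lemma conj {g : GroupLike k H} {x : H} (hx : IsSkewPrimitive k g.val 1 x) (a : GroupLike k H) :
    IsSkewPrimitive k (a * g * a⁻¹).val 1 (a.val * x * (a⁻¹).val) := by
  refine ⟨(a * g * a⁻¹).2, .one, ?_⟩
  rw [Bialgebra.comul_mul, Bialgebra.comul_mul, hx.comul_eq, a.2.comul_eq_tmul_self,
    (a⁻¹).2.comul_eq_tmul_self, mul_add, add_mul]
  simp only [Algebra.TensorProduct.tmul_mul_tmul, mul_one, val_mul_val_inv, GroupLike.val_mul]

lemma of_comul_mul_inv {a b : GroupLike k H} {y : H}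
    (h : Coalgebra.comul (R := k) y = a.val ⊗ₜ[k] y + y ⊗ₜ[k] b.val) :
    IsSkewPrimitive k (a * b⁻¹).val 1 (y * (b⁻¹).val) := by
  refine ⟨(a * b⁻¹).2, .one, ?_⟩
  rw [Bialgebra.comul_mul, h, (b⁻¹).2.comul_eq_tmul_self, add_mul]
  simp only [Algebra.TensorProduct.tmul_mul_tmul, val_mul_val_inv, GroupLike.val_mul]

/-- The only skew-primitive elements in the span of the grouplikes are the trivial ones. -/
lemma eq_smul_of_mem_groupSpan {g : GroupLike k H} {s : H} (hs : IsSkewPrimitive k g.val 1 s)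
    (hmem : s ∈ groupSpan k H) : ∃ c : k, s = c • (g.val - 1) := by
  classical
  obtain ⟨e, he⟩ := exists_dual_groupLike (k := k) g
  have h2 := hs.contractLeft_eq e
  clear hs
  have h1 : contractLeft e s = e s • g.val := by
    clear h2
    induction hmem using Submodule.span_induction with
    | mem x hx =>
      obtain ⟨a, rfl⟩ := hx
      rw [contractLeft_groupLike, he]
      split_ifs with h
      · rw [h]
      · simp
    | zero => simp
    | add x y _ _ hx hy => rw [map_add, map_add, hx, hy, _root_.add_smul]
    | smul c x _ hx => rw [map_smul, map_smul, hx, smul_assoc]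
  rw [he, if_pos rfl, one_smul, h1] at h2
  exact ⟨e s, by rw [smul_sub, h2]; abel⟩

lemma mem_coradicalFiltration_one (hp : IsPointed k H) [Fintype (GroupLike k H)]
    {g : GroupLike k H} {x : H} (hx : IsSkewPrimitive k g.val 1 x) :
    x ∈ coradicalFiltration k H 1 := by
  classical
  rw [PointedHopf.mem_coradicalFiltration_one hp]
  refine ⟨Pi.single g x, Pi.single 1 x, ?_⟩
  rw [hx.comul_eq, Finset.sum_eq_single g, Finset.sum_eq_single 1]
  · simp
  · intro b _ hb; simp [hb]
  · simp
  · intro b _ hb; simp [hb]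
  · simp

end IsSkewPrimitive

lemma contractLeft_mem_groupSpan (φ : H →ₗ[k] k) {z : H} (hz : z ∈ groupSpan k H) :
    contractLeft φ z ∈ groupSpan k H := by
  induction hz using Submodule.span_induction with
  | mem x hx =>
    obtain ⟨a, rfl⟩ := hx
    rw [contractLeft_groupLike]
    exact Submodule.smul_mem _ _ (groupLike_mem_groupSpan a)
  | zero => simp
  | add x y _ _ hx hy => rw [map_add]; exact Submodule.add_mem _ hx hy
  | smul c x _ hx => rw [map_smul]; exact Submodule.smul_mem _ _ hx

end HopfGroupSpan

/-! ### Hopf algebras of rank one -/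

section RankOne

variable {k : Type u} [Field k] {H : Type v} [Ring H] [HopfAlgebra k H]

lemma sum_groupLike_mul [Fintype (GroupLike k H)] {z : H} (hz : z ∈ groupSpan k H) :
    (∑ a : GroupLike k H, a.val) * z =
      Coalgebra.counit (R := k) z • ∑ a : GroupLike k H, a.val := by
  induction hz using Submodule.span_induction with
  | mem x hx =>
    obtain ⟨b, rfl⟩ := hx
    rw [b.2.counit_eq_one, one_smul, Finset.sum_mul]
    exact Fintype.sum_equiv (Equiv.mulRight b) _ _ fun a => rfl
  | zero => simp
  | add x y _ _ hx hy => rw [mul_add, hx, hy, map_add, add_smul]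
  | smul c x _ hx => rw [mul_smul_comm, hx, map_smul, smul_assoc]

/-- Left multiplication by the integral `∑ a` of the group algebra kills the relations that define
`k ⊗_{H₀} H₁`. -/
lemma sum_groupLike_mul_rankRelations (hp : IsPointed k H) [Fintype (GroupLike k H)]
    {r : coradicalFiltration k H 1} (hr : r ∈ rankRelations k H) :
    (∑ a : GroupLike k H, a.val) * (r : H) = 0 := by
  induction hr using Submodule.span_induction with
  | mem y hy =>
    obtain ⟨a, ha, h, hy⟩ := hy
    rw [coradicalFiltration_zero hp] at ha
    rw [hy, mul_sub, ← mul_assoc, sum_groupLike_mul ha, mul_smul_comm, smul_mul_assoc, sub_self]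
  | zero => simp
  | add x y _ _ hx hy => rw [Submodule.coe_add, mul_add, hx, hy, add_zero]
  | smul c x _ hx => rw [Submodule.coe_smul, mul_smul_comm, hx, smul_zero]

/-- Multiplying a skew-primitive element by the integral `∑ a` loses no information modulo the
group algebra: the component at the identity gives the element back. -/
lemma contractRight_sum_groupLike_mul [Fintype (GroupLike k H)] [DecidableEq (GroupLike k H)]
    {e : H →ₗ[k] k} (he : ∀ a : GroupLike k H, e a.val = if a = 1 then 1 else 0)
    {g : GroupLike k H} {x : H} (hx : IsSkewPrimitive k g.val 1 x) :
    contractRight e ((∑ a : GroupLike k H, a.val) * x) - x ∈ groupSpan k H := by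
  have h : ∀ a : GroupLike k H, contractRight e (a.val * x) =
      e (a.val * x) • (a * g).val + (if a = 1 then (1 : k) else 0) • (a.val * x) := by
    intro a
    rw [contractRight_apply, Bialgebra.comul_mul, hx.comul_eq, a.2.comul_eq_tmul_self, mul_add]
    simp [he]
  rw [Finset.sum_mul, map_sum, Finset.sum_congr rfl fun a _ => h a, Finset.sum_add_distrib]
  simp only [ite_smul, one_smul, zero_smul, Finset.sum_ite_eq', Finset.mem_univ, if_true,
    GroupLike.val_one, one_mul, add_sub_cancel_right]
  exact Submodule.sum_mem _ fun a _ => Submodule.smul_mem _ _ (groupLike_mem_groupSpan _)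

variable [FiniteDimensional k H]

/-- If `H₁` were contained in the group algebra, the class of `1` would span `k ⊗_{H₀} H₁`. -/
lemma HasRank.not_coradicalFiltration_one_le (hp : IsPointed k H) (hr : HasRank k H 1) :
    ¬ coradicalFiltration k H 1 ≤ groupSpan k H := by
  classical
  have := finite_groupLike (k := k) (C := H)
  have := Fintype.ofFinite (GroupLike k H)
  intro hle
  have h1 : (1 : H) ∈ coradicalFiltration k H 1 := by
    rw [mem_coradicalFiltration_one hp]
    refine ⟨Pi.single 1 1, 0, ?_⟩
    rw [Finset.sum_eq_single 1] <;> simp +contextual [Algebra.TensorProduct.one_def]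
  have hone := hr.finrank_eq
  have hspan : ∀ q : coradicalFiltration k H 1 ⧸ rankRelations k H,
      ∃ c : k, c • (rankRelations k H).mkQ ⟨1, h1⟩ = q := by
    intro q
    obtain ⟨z, rfl⟩ := Submodule.Quotient.mk_surjective _ q
    refine ⟨Coalgebra.counit (R := k) (z : H), ?_⟩
    rw [← map_smul, Submodule.mkQ_apply, eq_comm, Submodule.Quotient.eq]
    refine Submodule.subset_span ⟨z, ?_, ⟨1, h1⟩, ?_⟩
    · rw [coradicalFiltration_zero hp]; exact hle z.2
    · simp
  have := finrank_le_one _ hspan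
  omega

/-- The dimension count behind rank one: two skew-primitive elements outside the group algebra
become dependent, together with `1`, in the two-dimensional space `k ⊗_{H₀} H₁`, and the
dependency lifts to `H` modulo the group algebra. -/
lemma HasRank.exists_combination_mem_groupSpan (hp : IsPointed k H) (hr : HasRank k H 1)
    {g h : GroupLike k H} {x y : H} (hx : IsSkewPrimitive k g.val 1 x)
    (hy : IsSkewPrimitive k h.val 1 y) :
    ∃ β γ : k, (β ≠ 0 ∨ γ ≠ 0) ∧ β • x + γ • y ∈ groupSpan k H := by
  classical
  have := finite_groupLike (k := k) (C := H)
  have := Fintype.ofFinite (GroupLike k H)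
  have h1 : (1 : H) ∈ coradicalFiltration k H 1 := by
    rw [mem_coradicalFiltration_one hp]
    refine ⟨Pi.single 1 1, 0, ?_⟩
    rw [Finset.sum_eq_single 1] <;> simp +contextual [Algebra.TensorProduct.one_def]
  let m : Fin 3 → coradicalFiltration k H 1 := ![⟨1, h1⟩,
    ⟨x, hx.mem_coradicalFiltration_one hp⟩, ⟨y, hy.mem_coradicalFiltration_one hp⟩]
  have hdep : ¬ LinearIndependent k fun i => (rankRelations k H).mkQ (m i) := by
    intro hli
    have := hli.fintype_card_le_finrank
    rw [hr.finrank_eq, Fintype.card_fin] at this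
    omega
  obtain ⟨c, hc, hne⟩ := Fintype.not_linearIndependent_iff.1 hdep
  have hrel : ∑ i, c i • m i ∈ rankRelations k H := by
    rw [← Submodule.Quotient.mk_eq_zero, ← Submodule.mkQ_apply, map_sum]
    simpa only [map_smul] using hc
  have hN := sum_groupLike_mul_rankRelations hp hrel
  simp only [Fin.sum_univ_three, m, Submodule.coe_add, Submodule.coe_smul, Matrix.cons_val_zero,
    Matrix.cons_val_one, Matrix.cons_val] at hN
  obtain ⟨e, he⟩ := exists_dual_groupLike (k := k) (1 : GroupLike k H)
  have hx' := contractRight_sum_groupLike_mul he hx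
  have hy' := contractRight_sum_groupLike_mul he hy
  set N : H := ∑ a : GroupLike k H, a.val with hNdef
  rw [mul_add, mul_add, mul_smul_comm, mul_smul_comm, mul_smul_comm, mul_one] at hN
  have hNmem : contractRight e N ∈ groupSpan k H := by
    rw [hNdef, map_sum]
    refine Submodule.sum_mem _ fun a _ => ?_
    rw [contractRight_groupLike]
    exact Submodule.smul_mem _ _ (groupLike_mem_groupSpan a)
  refine ⟨c 1, c 2, ?_, ?_⟩
  · by_contra! hzero
    obtain ⟨h10, h20⟩ := hzero
    rw [h10, h20, zero_smul, zero_smul, add_zero, add_zero] at hN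
    have h0 : ∑ a : GroupLike k H, c 0 • a.val = 0 := by rw [← Finset.smul_sum]; exact hN
    have hli := Fintype.linearIndependent_iff.1
      (linearIndep_groupLikeVal (R := k) (A := H)) (fun _ => c 0) h0 1
    obtain ⟨i, hi⟩ := hne
    fin_cases i <;> simp_all
  · have hsum := congrArg (contractRight e) hN
    rw [map_add, map_add, map_smul, map_smul, map_smul, map_zero] at hsum
    have hmem := Submodule.add_mem _ (Submodule.add_mem _ (Submodule.smul_mem _ (c 0) hNmem)
      (Submodule.smul_mem _ (c 1) hx')) (Submodule.smul_mem _ (c 2) hy')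
    have heq : c 0 • contractRight e N + c 1 • (contractRight e (N * x) - x) +
        c 2 • (contractRight e (N * y) - y) = -(c 1 • x + c 2 • y) := by
      rw [smul_sub, smul_sub, ← sub_eq_zero, ← hsum]
      abel
    rw [heq] at hmem
    exact neg_mem_iff.1 hmem

/-- In rank one the nontrivial skew-primitive elements all belong to the same grouplike. -/
lemma HasRank.groupLike_eq (hp : IsPointed k H) (hr : HasRank k H 1)
    {g h : GroupLike k H} {x y : H} (hx : IsSkewPrimitive k g.val 1 x) (hxn : x ∉ groupSpan k H)
    (hy : IsSkewPrimitive k h.val 1 y) (hyn : y ∉ groupSpan k H) : h = g := by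
  classical
  by_contra hne
  obtain ⟨β, γ, hβγ, hmem⟩ := hr.exists_combination_mem_groupSpan hp hx hy
  obtain ⟨e, he⟩ := exists_dual_groupLike (k := k) g
  have hmem' := contractLeft_mem_groupSpan e hmem
  rw [map_add, map_smul, map_smul, hx.contractLeft_eq, hy.contractLeft_eq, he, he, if_pos rfl,
    if_neg hne, one_smul, zero_smul, zero_add] at hmem'
  have hone : ∀ c : k, c • (1 : H) ∈ groupSpan k H := fun c =>
    Submodule.smul_mem _ _ one_mem_groupSpan
  have hβx : β • x ∈ groupSpan k H := by
    rw [smul_add, add_assoc] at hmem'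
    exact (Submodule.add_mem_iff_left _ (Submodule.add_mem _ (Submodule.smul_mem _ _ (hone _))
      (Submodule.smul_mem _ _ (hone _)))).1 hmem'
  have hβ : β = 0 := by
    by_contra hβ
    exact hxn ((Submodule.smul_mem_iff _ hβ).1 hβx)
  have hγ : γ ≠ 0 := hβγ.resolve_left (not_not.2 hβ)
  rw [hβ, zero_smul, zero_add] at hmem
  exact hyn ((Submodule.smul_mem_iff _ hγ).1 hmem)

/-- In rank one the skew-primitive elements for a fixed grouplike are unique up to scalars and
trivial ones. -/
lemma HasRank.exists_eq_smul_add (hp : IsPointed k H) (hr : HasRank k H 1)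
    {g : GroupLike k H} {x y : H} (hx : IsSkewPrimitive k g.val 1 x) (hxn : x ∉ groupSpan k H)
    (hy : IsSkewPrimitive k g.val 1 y) : ∃ β γ : k, y = β • x + γ • (g.val - 1) := by
  obtain ⟨β, γ, hβγ, hmem⟩ := hr.exists_combination_mem_groupSpan hp hx hy
  obtain ⟨c, hc⟩ := (hx.add_smul hy β γ).eq_smul_of_mem_groupSpan hmem
  have hγ : γ ≠ 0 := by
    rintro rfl
    rw [zero_smul, add_zero] at hmem
    have hβ : β ≠ 0 := hβγ.resolve_right (by simp)
    exact hxn ((Submodule.smul_mem_iff _ hβ).1 hmem)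
  refine ⟨-(γ⁻¹ * β), γ⁻¹ * c, ?_⟩
  have : y = γ⁻¹ • (γ • y) := by rw [smul_smul, inv_mul_cancel₀ hγ, one_smul]
  rw [this, eq_sub_of_add_eq' hc]
  module

lemma HasRank.exists_skewPrimitive (hp : IsPointed k H) (hr : HasRank k H 1) :
    ∃ (g : GroupLike k H) (x : H), IsSkewPrimitive k g.val 1 x ∧ x ∉ groupSpan k H := by
  classical
  have := finite_groupLike (k := k) (C := H)
  have := Fintype.ofFinite (GroupLike k H)
  by_contra! hall
  refine hr.not_coradicalFiltration_one_le hp fun z hz => ?_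
  obtain ⟨y, hy, hzy⟩ := mem_coradicalFiltration_one_decomp hp hz
  refine (Submodule.sub_mem_iff_left _ ?_).1 hzy
  exact Submodule.sum_mem _ fun a _ => Submodule.sum_mem _ fun b _ =>
    (mul_groupLike_mem_groupSpan_iff b⁻¹).1
      (hall _ _ (IsSkewPrimitive.of_comul_mul_inv (hy a b)))

/-- Conjugation by a grouplike permutes the nontrivial skew-primitive elements, which in rank one
determines it up to scalars and trivial elements. In particular `g` is central. -/
lemma HasRank.conj_eq (hp : IsPointed k H) (hr : HasRank k H 1)
    {g : GroupLike k H} {x : H} (hx : IsSkewPrimitive k g.val 1 x) (hxn : x ∉ groupSpan k H)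
    (a : GroupLike k H) : a * g * a⁻¹ = g ∧
      ∃ β γ : k, a.val * x * (a⁻¹).val = β • x + γ • (g.val - 1) := by
  have hconj := hx.conj a
  have hn : a.val * x * (a⁻¹).val ∉ groupSpan k H := by
    rwa [mul_groupLike_mem_groupSpan_iff, groupLike_mul_mem_groupSpan_iff]
  have hg := hr.groupLike_eq hp hx hxn hconj hn
  rw [hg] at hconj
  exact ⟨hg, hr.exists_eq_smul_add hp hx hxn hconj⟩

/-- By the Taft–Wilson theorem `H₁`, and so `H`, is generated by the grouplikes and any one
nontrivial skew-primitive element. -/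
theorem HasRank.isGeneratingPair (hp : IsPointed k H) (hr : HasRank k H 1)
    {g : GroupLike k H} {x : H} (hx : IsSkewPrimitive k g.val 1 x) (hxn : x ∉ groupSpan k H) :
    IsGeneratingPair k g x := by
  classical
  have := finite_groupLike (k := k) (C := H)
  have := Fintype.ofFinite (GroupLike k H)
  refine ⟨Subgroup.mem_center_iff.2 fun a => mul_inv_eq_iff_eq_mul.1 (hr.conj_eq hp hx hxn a).1,
    hx, ?_⟩
  set A := Algebra.adjoin k (insert x {a : H | IsGroupLikeElem k a}) with hA
  have hgl : ∀ a : GroupLike k H, a.val ∈ A := fun a =>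
    Algebra.subset_adjoin (Set.mem_insert_of_mem _ a.2)
  have hgs : groupSpan k H ≤ Subalgebra.toSubmodule A := by
    rw [groupSpan, Submodule.span_le]
    rintro _ ⟨a, rfl⟩
    exact hgl a
  have hxA : x ∈ A := Algebra.subset_adjoin (Set.mem_insert _ _)
  rw [eq_top_iff, ← hr.adjoin_eq_top]
  refine Algebra.adjoin_le fun z hz => ?_
  obtain ⟨y, hy, hzy⟩ := mem_coradicalFiltration_one_decomp hp hz
  have hyA : ∀ a b, y a b ∈ A := by
    intro a b
    have hs := IsSkewPrimitive.of_comul_mul_inv (hy a b)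
    have hprod : y a b * (b⁻¹).val ∈ A := by
      by_cases hn : y a b * (b⁻¹).val ∈ groupSpan k H
      · exact hgs hn
      · rw [hr.groupLike_eq hp hx hxn hs hn] at hs
        obtain ⟨β, γ, h⟩ := hr.exists_eq_smul_add hp hx hxn hs
        rw [h]
        exact A.add_mem (A.smul_mem hxA _) (A.smul_mem (A.sub_mem (hgl g) A.one_mem) _)
    have := A.mul_mem hprod (hgl b)
    rwa [mul_assoc, val_inv_mul_val, mul_one] at this
  have := A.add_mem (hgs hzy) (A.sum_mem fun a (_ : a ∈ Finset.univ) =>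
    A.sum_mem fun b (_ : b ∈ Finset.univ) => hyA a b)
  simpa using this

lemma IsGeneratingPair.notMem_groupSpan (hp : IsPointed k H) (hr : HasRank k H 1)
    {g : GroupLike k H} {x : H} (h : IsGeneratingPair k g x) : x ∉ groupSpan k H := by
  intro hx
  refine hr.not_coradicalFiltration_one_le hp fun z _ => adjoin_le_groupSpan
    (s := insert x {a : H | IsGroupLikeElem k a}) ?_ (by rw [h.adjoin_eq_top]; trivial)
  rintro y (rfl | hy)
  · exact hx
  · exact groupLike_mem_groupSpan ⟨y, hy⟩

end RankOne

/-! ### Coideals -/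

section Coideal

variable {k : Type u} [Field k] {C : Type v} [AddCommGroup C] [Module k C] [Coalgebra k C]

lemma isCoideal_bot : (⊥ : Submodule k C).IsCoideal := by
  rw [Submodule.isCoideal_iff]
  refine ⟨fun x hx => ?_, fun x hx => ?_⟩ <;> rw [(Submodule.mem_bot k).1 hx] <;> simp

lemma contractLeft_mem_of_isCoideal {W : Submodule k C} (hW : W.IsCoideal) {φ : C →ₗ[k] k}
    (hφ : ∀ w ∈ W, φ w = 0) {w : C} (hw : w ∈ W) : contractLeft φ w ∈ W := by
  have hφ' : W ≤ LinearMap.ker φ := hφ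
  have h : ∀ T : C ⊗[k] C, W.mkQ (TensorProduct.lid k C (φ.rTensor C T)) =
      TensorProduct.lid k (C ⧸ W) ((W.liftQ φ hφ').rTensor (C ⧸ W)
        (TensorProduct.map W.mkQ W.mkQ T)) := by
    intro T
    induction T with
    | zero => simp
    | add p q hp hq => simp only [map_add, hp, hq]
    | tmul p q => simp
  rw [← Submodule.Quotient.mk_eq_zero, ← Submodule.mkQ_apply, contractLeft_apply, h,
    hW.map_mkQ_comul_eq_zero hw, map_zero, map_zero]

lemma contractRight_mem_of_isCoideal {W : Submodule k C} (hW : W.IsCoideal) {φ : C →ₗ[k] k}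
    (hφ : ∀ w ∈ W, φ w = 0) {w : C} (hw : w ∈ W) : contractRight φ w ∈ W := by
  have hφ' : W ≤ LinearMap.ker φ := hφ
  have h : ∀ T : C ⊗[k] C, W.mkQ (TensorProduct.rid k C (φ.lTensor C T)) =
      TensorProduct.rid k (C ⧸ W) ((W.liftQ φ hφ').lTensor (C ⧸ W)
        (TensorProduct.map W.mkQ W.mkQ T)) := by
    intro T
    induction T with
    | zero => simp
    | add p q hp hq => simp only [map_add, hp, hq]
    | tmul p q => simp
  rw [← Submodule.Quotient.mk_eq_zero, ← Submodule.mkQ_apply, contractRight_apply, h,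
    hW.map_mkQ_comul_eq_zero hw, map_zero, map_zero]

/-- A functional that kills a subspace `W` and has prescribed values on a family that is linearly
independent modulo `W`. -/
lemma exists_dual_of_linearIndependent_mkQ {k V ι : Type*} [Field k] [AddCommGroup V] [Module k V]
    [Fintype ι] {W : Submodule k V} {b : ι → V}
    (hb : ∀ c : ι → k, ∑ i, c i • b i ∈ W → ∀ i, c i = 0) (d : ι → k) :
    ∃ f : V →ₗ[k] k, (∀ w ∈ W, f w = 0) ∧ ∀ i, f (b i) = d i := by
  have hli : LinearIndependent k fun i => W.mkQ (b i) := by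
    rw [Fintype.linearIndependent_iff]
    intro c hc
    apply hb c
    rw [← Submodule.Quotient.mk_eq_zero, ← Submodule.mkQ_apply, map_sum]
    simpa only [map_smul] using hc
  obtain ⟨f, hf⟩ := exists_dual_of_linearIndependent hli d
  exact ⟨f ∘ₗ W.mkQ, fun w hw => by simp [(Submodule.Quotient.mk_eq_zero W).2 hw], hf⟩

end Coideal

/-! ### Lowering the degree in a skew-primitive element -/

section Lowering

variable {k : Type u} [Field k] {H : Type v} [Ring H] [HopfAlgebra k H]

/-- The span of the elements `xʲ a` with `j < i` and `a` grouplike. -/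
def powerSpan (k : Type u) [Field k] {H : Type v} [Ring H] [HopfAlgebra k H] (x : H) (i : ℕ) :
    Submodule k H :=
  Submodule.span k {y | ∃ j < i, ∃ a : GroupLike k H, y = x ^ j * a.val}

lemma pow_mul_mem_powerSpan (x : H) {i j : ℕ} (h : j < i) (a : GroupLike k H) :
    x ^ j * a.val ∈ powerSpan k x i :=
  Submodule.subset_span ⟨j, h, a, rfl⟩

lemma powerSpan_mono (x : H) {i j : ℕ} (h : i ≤ j) : powerSpan k x i ≤ powerSpan k x j := by
  apply Submodule.span_mono
  rintro _ ⟨l, hl, a, rfl⟩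
  exact ⟨l, hl.trans_le h, a, rfl⟩

lemma mul_mem_powerSpan (x : H) {i : ℕ} {z : H} (hz : z ∈ powerSpan k x i) :
    x * z ∈ powerSpan k x (i + 1) := by
  induction hz using Submodule.span_induction with
  | mem y hy =>
    obtain ⟨j, hj, a, rfl⟩ := hy
    rw [← mul_assoc, ← pow_succ']
    exact pow_mul_mem_powerSpan x (by omega) a
  | zero => simp
  | add y z _ _ hy hz => rw [mul_add]; exact Submodule.add_mem _ hy hz
  | smul c y _ hy => rw [mul_smul_comm]; exact Submodule.smul_mem _ _ hy

namespace IsSkewPrimitive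

variable {g : GroupLike k H} {x : H}

/-- The twisted Leibniz rule for `(φ ⊗ id) ∘ Δ` at a product with a skew-primitive element. -/
lemma contractLeft_mul (hx : IsSkewPrimitive k g.val 1 x) (φ : H →ₗ[k] k) (h : H) :
    contractLeft φ (x * h) = x * contractLeft (φ ∘ₗ LinearMap.mulLeft k g.val) h +
      contractLeft (φ ∘ₗ LinearMap.mulLeft k x) h := by
  simp only [contractLeft_apply, Bialgebra.comul_mul, hx.comul_eq, add_mul, map_add]
  generalize Coalgebra.comul (R := k) h = T
  induction T with
  | zero => simp
  | add p q hp hq =>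
    simp only [mul_add, map_add] at hp hq ⊢
    rw [← sub_eq_zero] at hp hq ⊢
    rw [← add_zero (0 : H)]
    nth_rw 1 [← hp]
    rw [← hq]
    abel
  | tmul p q => simp

/-- The leading term of `(φ ⊗ id) ∘ Δ` at `xⁱ a`, for an arbitrary functional `φ`. -/
lemma contractLeft_pow_mul_sub_mem (hx : IsSkewPrimitive k g.val 1 x) (i : ℕ) :
    ∀ (φ : H →ₗ[k] k) (a : GroupLike k H),
      contractLeft φ (x ^ i * a.val) - φ (g.val ^ i * a.val) • (x ^ i * a.val) ∈
        powerSpan k x i := by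
  induction i with
  | zero => intro φ a; simp [contractLeft_groupLike]
  | succ i ih =>
    intro φ a
    have h1 := ih (φ ∘ₗ LinearMap.mulLeft k g.val) a
    have h2 := ih (φ ∘ₗ LinearMap.mulLeft k x) a
    have h2' := Submodule.add_mem _ (powerSpan_mono x (Nat.le_succ i) h2)
      (Submodule.smul_mem _ ((φ ∘ₗ LinearMap.mulLeft k x) (g.val ^ i * a.val))
        (pow_mul_mem_powerSpan x (Nat.lt_succ_self i) a))
    rw [sub_add_cancel] at h2'
    have h3 := Submodule.add_mem _ (mul_mem_powerSpan x h1) h2'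
    rw [pow_succ', mul_assoc, hx.contractLeft_mul, add_sub_right_comm]
    convert h3 using 2
    rw [mul_sub, mul_smul_comm, pow_succ', mul_assoc]
    rfl

/-- If `φ` kills the grouplikes, then `(φ ⊗ id) ∘ Δ` lowers the degree in `x` by one, with the
leading coefficient shown. -/
lemma contractLeft_pow_succ_mul_sub_mem (hx : IsSkewPrimitive k g.val 1 x) (i : ℕ) :
    ∀ (φ : H →ₗ[k] k), (∀ a : GroupLike k H, φ a.val = 0) → ∀ a : GroupLike k H,
      contractLeft φ (x ^ (i + 1) * a.val) -
        (∑ s ∈ Finset.range (i + 1), φ (g.val ^ s * x * g.val ^ (i - s) * a.val)) •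
          (x ^ i * a.val) ∈ powerSpan k x i := by
  induction i with
  | zero =>
    intro φ hφ a
    have : (φ ∘ₗ LinearMap.mulLeft k g.val) a.val = 0 := hφ (g * a)
    rw [zero_add, pow_one, hx.contractLeft_mul, contractLeft_groupLike, contractLeft_groupLike,
      this]
    simp
  | succ i ih =>
    intro φ hφ a
    have h1 := ih (φ ∘ₗ LinearMap.mulLeft k g.val) (fun b => hφ (g * b)) a
    have h2 := hx.contractLeft_pow_mul_sub_mem (i + 1) (φ ∘ₗ LinearMap.mulLeft k x) a
    have h3 := Submodule.add_mem _ (mul_mem_powerSpan x h1) h2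
    rw [pow_succ' x (i + 1), mul_assoc x, hx.contractLeft_mul, Finset.sum_range_succ']
    convert h3 using 1
    rw [mul_sub, mul_smul_comm, ← mul_assoc x (x ^ i), ← pow_succ', _root_.add_smul]
    simp only [LinearMap.comp_apply, LinearMap.mulLeft_apply, Nat.add_sub_add_right, pow_zero,
      one_mul, Nat.sub_zero, ← mul_assoc, ← pow_succ']
    abel

variable {ζ : k}

lemma groupLike_pow_mul (hgx : g.val * x = ζ • (x * g.val)) (s : ℕ) :
    g.val ^ s * x = ζ ^ s • (x * g.val ^ s) := by
  induction s with
  | zero => simp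
  | succ s ih =>
    rw [pow_succ, mul_assoc, hgx, mul_smul_comm, ← mul_assoc, ih, smul_mul_assoc, smul_smul,
      mul_assoc, ← pow_succ, ← pow_succ']

/-- When `g x = ζ x g` and `f` is `0` on the grouplikes `a` and `1` on the elements `x a`, the
operator `(f ⊗ id) ∘ Δ` behaves like a `ζ`-derivative in `x`. -/
lemma contractLeft_pow_succ_mul_sub_mem' (hx : IsSkewPrimitive k g.val 1 x)
    (hgx : g.val * x = ζ • (x * g.val)) {f : H →ₗ[k] k} (hf0 : ∀ a : GroupLike k H, f a.val = 0)
    (hf1 : ∀ a : GroupLike k H, f (x * a.val) = 1) (i : ℕ) (a : GroupLike k H) :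
    contractLeft f (x ^ (i + 1) * a.val) -
      (∑ s ∈ Finset.range (i + 1), ζ ^ s) • (x ^ i * a.val) ∈ powerSpan k x i := by
  have h := hx.contractLeft_pow_succ_mul_sub_mem i f hf0 a
  rwa [Finset.sum_congr rfl fun s hs => ?_] at h
  have hs' : s + (i - s) = i := by have := Finset.mem_range.1 hs; omega
  rw [groupLike_pow_mul hgx, smul_mul_assoc, smul_mul_assoc, map_smul, mul_assoc x, ← pow_add, hs',
    mul_assoc, ← GroupLike.val_pow, ← GroupLike.val_mul, hf1, smul_eq_mul, mul_one]

lemma contractLeft_mem_powerSpan (hx : IsSkewPrimitive k g.val 1 x)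
    (hgx : g.val * x = ζ • (x * g.val)) {f : H →ₗ[k] k} (hf0 : ∀ a : GroupLike k H, f a.val = 0)
    (hf1 : ∀ a : GroupLike k H, f (x * a.val) = 1) {i : ℕ} {z : H}
    (hz : z ∈ powerSpan k x (i + 1)) : contractLeft f z ∈ powerSpan k x i := by
  induction hz using Submodule.span_induction with
  | mem y hy =>
    obtain ⟨j, hj, a, rfl⟩ := hy
    cases j with
    | zero => simp [contractLeft_groupLike, hf0]
    | succ j =>
      have h := hx.contractLeft_pow_succ_mul_sub_mem' hgx hf0 hf1 j a
      have h' := Submodule.add_mem _ (powerSpan_mono x (by omega : j ≤ i) h)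
        (Submodule.smul_mem _ (∑ s ∈ Finset.range (j + 1), ζ ^ s)
          (pow_mul_mem_powerSpan x (by omega : j < i) a))
      rwa [sub_add_cancel] at h'
  | zero => simp
  | add y z _ _ hy hz => rw [map_add]; exact Submodule.add_mem _ hy hz
  | smul c y _ hy => rw [map_smul]; exact Submodule.smul_mem _ _ hy

lemma powerSpan_zero (x : H) : powerSpan k x 0 = ⊥ := by
  simp [powerSpan]

lemma iterate_contractLeft_eq_zero (hx : IsSkewPrimitive k g.val 1 x)
    (hgx : g.val * x = ζ • (x * g.val)) {f : H →ₗ[k] k} (hf0 : ∀ a : GroupLike k H, f a.val = 0)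
    (hf1 : ∀ a : GroupLike k H, f (x * a.val) = 1) (i : ℕ) : ∀ {z : H},
    z ∈ powerSpan k x i → (contractLeft f ^ i) z = 0 := by
  induction i with
  | zero => intro z hz; rw [powerSpan_zero] at hz; rw [(Submodule.mem_bot k).1 hz, map_zero]
  | succ i ih =>
    intro z hz
    rw [pow_succ, Module.End.mul_apply]
    exact ih (hx.contractLeft_mem_powerSpan hgx hf0 hf1 hz)

lemma iterate_contractLeft_pow_mul (hx : IsSkewPrimitive k g.val 1 x)
    (hgx : g.val * x = ζ • (x * g.val)) {f : H →ₗ[k] k} (hf0 : ∀ a : GroupLike k H, f a.val = 0)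
    (hf1 : ∀ a : GroupLike k H, f (x * a.val) = 1) (i : ℕ) (a : GroupLike k H) :
    (contractLeft f ^ i) (x ^ i * a.val) =
      (∏ j ∈ Finset.range i, ∑ s ∈ Finset.range (j + 1), ζ ^ s) • a.val := by
  induction i with
  | zero => simp
  | succ i ih =>
    have h := hx.iterate_contractLeft_eq_zero hgx hf0 hf1 i
      (hx.contractLeft_pow_succ_mul_sub_mem' hgx hf0 hf1 i a)
    rw [map_sub, map_smul, sub_eq_zero] at h
    rw [pow_succ (contractLeft f), Module.End.mul_apply, h, ih, smul_smul, Finset.prod_range_succ,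
      mul_comm]

section Independence

variable [Fintype (GroupLike k H)] {W : Submodule k H}

/-- Modulo a coideal `W` that meets the group algebra trivially and contains no nontrivial
skew-primitive element `d x b + α (g b - b)`, the elements `a` and `x a` are independent. -/
lemma coeff_eq_zero_of_degree_one (hx : IsSkewPrimitive k g.val 1 x) (hW : W.IsCoideal)
    (hW0 : ∀ z ∈ groupSpan k H, z ∈ W → z = 0)
    (hW1 : ∀ (d α : k) (b : GroupLike k H),
      d • (x * b.val) + α • ((g * b).val - b.val) ∈ W → d = 0)
    (c d : GroupLike k H → k)
    (h : ∑ a, c a • a.val + ∑ a, d a • (x * a.val) ∈ W) : (∀ a, c a = 0) ∧ ∀ a, d a = 0 := by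
  classical
  have hG : ∀ c : GroupLike k H → k, ∑ a, c a • a.val ∈ W → ∀ a, c a = 0 := fun c hc =>
    Fintype.linearIndependent_iff.1 (linearIndep_groupLikeVal (R := k) (A := H)) c
      (hW0 _ (mem_groupSpan_iff.2 ⟨c, rfl⟩) hc)
  have hdual : ∀ b : GroupLike k H, ∃ f : H →ₗ[k] k, (∀ w ∈ W, f w = 0) ∧
      ∀ a : GroupLike k H, f a.val = if a = b then 1 else 0 := fun b =>
    exists_dual_of_linearIndependent_mkQ hG _
  have hd : ∀ b, d b = 0 := by
    intro b
    obtain ⟨e, heW, he⟩ := hdual b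
    obtain ⟨e', heW', he'⟩ := hdual (g * b)
    have hcomul : ∀ a : GroupLike k H, Coalgebra.comul (R := k) (x * a.val) =
        (g * a).val ⊗ₜ[k] (x * a.val) + (x * a.val) ⊗ₜ[k] a.val := by
      intro a
      rw [Bialgebra.comul_mul, hx.comul_eq, a.2.comul_eq_tmul_self, add_mul]
      simp
    have hR : ∀ a : GroupLike k H, contractRight e (x * a.val) =
        e (x * a.val) • (g * a).val + (if a = b then (1 : k) else 0) • (x * a.val) := by
      intro a
      rw [contractRight_apply, hcomul]
      simp [he]
    -- The component of `w` at `b` on the right, then at `g b` on the left.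
    have h1 := contractRight_mem_of_isCoideal hW heW h
    have h2 := contractLeft_mem_of_isCoideal hW heW' h1
    have hw1 : contractRight e (∑ a, c a • a.val + ∑ a, d a • (x * a.val)) =
        c b • b.val + d b • (x * b.val) +
          ∑ a : GroupLike k H, (d a * e (x * a.val)) • (g * a).val := by
      rw [map_add, map_sum, map_sum]
      simp only [map_smul, contractRight_groupLike, hR, he, smul_add, ite_smul, one_smul,
        zero_smul, smul_ite, smul_zero, Finset.sum_add_distrib, Finset.sum_ite_eq',
        Finset.mem_univ, if_true, smul_smul]
      abel
    have hL : contractLeft e' (x * b.val) = x * b.val + e' (x * b.val) • b.val := by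
      rw [contractLeft_apply, hcomul]
      simp [he', -GroupLike.val_mul]
    have h3 : ∃ α β : k, d b • (x * b.val) + (α • (g * b).val + β • b.val) ∈ W := by
      refine ⟨d b * e (x * b.val), c b * e' b.val + d b * e' (x * b.val), ?_⟩
      convert h2 using 1
      rw [hw1, map_add, map_add, map_sum]
      simp only [map_smul, contractLeft_groupLike, he', hL, mul_right_inj, ite_smul, one_smul,
        zero_smul, smul_ite, smul_zero, Finset.sum_ite_eq', Finset.mem_univ, if_true]
      split_ifs <;> module
    obtain ⟨α, β, hαβ⟩ := h3
    have hε := hW.counit_eq_zero hαβ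
    have hx0 : Coalgebra.counit (R := k) (x * b.val) = 0 := by
      rw [Bialgebra.counit_mul, hx.counit_eq_zero, zero_mul]
    rw [map_add, map_add, map_smul, map_smul, map_smul, hx0, (g * b).2.counit_eq_one,
      b.2.counit_eq_one, smul_zero, zero_add, smul_eq_mul, smul_eq_mul, mul_one, mul_one] at hε
    apply hW1 (d b) α b
    rw [smul_sub, sub_eq_add_neg, ← neg_smul, ← eq_neg_of_add_eq_zero_right hε]
    exact hαβ
  refine ⟨hG c ?_, hd⟩
  simpa [hd] using h

/-- The elements `xⁱ a` with `i < m` are independent modulo a coideal `W` as soon as `W` contains no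
nonzero skew-primitive element, provided that the `ζ`-integers below `m` do not vanish. -/
theorem coeff_eq_zero (hx : IsSkewPrimitive k g.val 1 x)
    (hgx : g.val * x = ζ • (x * g.val)) (hW : W.IsCoideal)
    (hW0 : ∀ z ∈ groupSpan k H, z ∈ W → z = 0)
    (hW1 : ∀ (d α : k) (b : GroupLike k H),
      d • (x * b.val) + α • ((g * b).val - b.val) ∈ W → d = 0)
    (m : ℕ) (hm : ∀ j, j + 1 < m → ∑ s ∈ Finset.range (j + 1), ζ ^ s ≠ 0)
    (c : ℕ → GroupLike k H → k)
    (h : ∑ i ∈ Finset.range m, ∑ a, c i a • (x ^ i * a.val) ∈ W) :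
    ∀ i < m, ∀ a, c i a = 0 := by
  obtain ⟨f, hfW, hf⟩ := exists_dual_of_linearIndependent_mkQ (W := W)
    (b := Sum.elim (fun a : GroupLike k H => a.val) fun a : GroupLike k H => x * a.val)
    (fun c hc => by
      rw [Fintype.sum_sum_type] at hc
      have := hx.coeff_eq_zero_of_degree_one hW hW0 hW1 (fun a => c (.inl a))
        (fun a => c (.inr a)) hc
      rintro (a | a)
      exacts [this.1 a, this.2 a])
    (Sum.elim (fun _ => 0) fun _ => 1)
  have hf0 : ∀ a : GroupLike k H, f a.val = 0 := fun a => hf (.inl a)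
  have hf1 : ∀ a : GroupLike k H, f (x * a.val) = 1 := fun a => hf (.inr a)
  have hiter : ∀ (i : ℕ) {w : H}, w ∈ W → (contractLeft f ^ i) w ∈ W := by
    intro i
    induction i with
    | zero => intro w hw; exact hw
    | succ i ih =>
      intro w hw
      rw [pow_succ, Module.End.mul_apply]
      exact ih (contractLeft_mem_of_isCoideal hW hfW hw)
  induction m with
  | zero => intro i hi; omega
  | succ m ih =>
    have hlow : ∑ i ∈ Finset.range m, ∑ a, c i a • (x ^ i * a.val) ∈ powerSpan k x m :=
      Submodule.sum_mem _ fun i hi => Submodule.sum_mem _ fun a _ =>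
        Submodule.smul_mem _ _ (pow_mul_mem_powerSpan x (Finset.mem_range.1 hi) a)
    have h' := hiter m h
    rw [Finset.sum_range_succ, map_add, hx.iterate_contractLeft_eq_zero hgx hf0 hf1 m hlow,
      zero_add, map_sum] at h'
    simp only [map_smul, hx.iterate_contractLeft_pow_mul hgx hf0 hf1 m, smul_smul] at h'
    have h0 := Fintype.linearIndependent_iff.1 (linearIndep_groupLikeVal (R := k) (A := H)) _
      (hW0 _ (mem_groupSpan_iff.2 ⟨_, rfl⟩) h')
    have hprod : ∏ j ∈ Finset.range m, ∑ s ∈ Finset.range (j + 1), ζ ^ s ≠ 0 :=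
      Finset.prod_ne_zero_iff.2 fun j hj => hm j (by have := Finset.mem_range.1 hj; omega)
    have hcm : ∀ a, c m a = 0 := fun a => (mul_eq_zero.1 (h0 a)).resolve_right hprod
    have h'' : ∑ i ∈ Finset.range m, ∑ a, c i a • (x ^ i * a.val) ∈ W := by
      rw [Finset.sum_range_succ] at h
      simpa [hcm] using h
    intro i hi a
    rcases Nat.lt_succ_iff_lt_or_eq.1 hi with hlt | rfl
    · exact ih (fun j hj => hm j (by omega)) h'' i hlt a
    · exact hcm a

lemma pow_mul_coeff_eq_zero (hx : IsSkewPrimitive k g.val 1 x) (hxn : x ∉ groupSpan k H)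
    (hgx : g.val * x = ζ • (x * g.val))
    (m : ℕ) (hm : ∀ j, j + 1 < m → ∑ s ∈ Finset.range (j + 1), ζ ^ s ≠ 0)
    (c : ℕ → GroupLike k H → k)
    (h : ∑ i ∈ Finset.range m, ∑ a, c i a • (x ^ i * a.val) = 0) :
    ∀ i < m, ∀ a, c i a = 0 := by
  refine hx.coeff_eq_zero hgx isCoideal_bot (fun z _ hz => (Submodule.mem_bot k).1 hz) ?_ m hm c
    ((Submodule.mem_bot k).2 h)
  intro d α b hb
  by_contra hd
  rw [Submodule.mem_bot] at hb
  apply hxn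
  rw [← mul_groupLike_mem_groupSpan_iff b, ← Submodule.smul_mem_iff _ hd,
    eq_neg_of_add_eq_zero_left hb]
  exact neg_mem (Submodule.smul_mem _ _ (Submodule.sub_mem _ (groupLike_mem_groupSpan _)
    (groupLike_mem_groupSpan _)))

/-- In characteristic zero a finite-dimensional Hopf algebra has no nontrivial skew-primitive
element `x` that commutes with `g`: the powers of `x` would be independent. -/
lemma mem_groupSpan_of_commute [CharZero k] [FiniteDimensional k H]
    (hx : IsSkewPrimitive k g.val 1 x) (hgx : g.val * x = x * g.val) : x ∈ groupSpan k H := by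
  classical
  by_contra hxn
  have hli : LinearIndependent k fun i : ℕ => x ^ i := by
    rw [linearIndependent_iff_finset_linearIndependent]
    intro s
    obtain ⟨m, hm⟩ := s.exists_nat_subset_range
    have hr : LinearIndependent k fun i : Fin m => x ^ (i : ℕ) := by
      rw [Fintype.linearIndependent_iff]
      intro c hc i
      have := hx.pow_mul_coeff_eq_zero hxn (ζ := 1) (by rw [one_smul, hgx]) m
        (fun j _ => by simpa using! Nat.cast_add_one_ne_zero j)
        (fun i a => if a = 1 then (if h : i < m then c ⟨i, h⟩ else 0) else 0)
        (by
          rw [Finset.sum_range, ← hc]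
          refine Finset.sum_congr rfl fun i _ => ?_
          rw [Finset.sum_eq_single 1 (by simp +contextual) (by simp)]
          simp) i i.2 1
      simpa using this
    exact hr.comp (fun i : s => (⟨i, Finset.mem_range.1 (hm i.2)⟩ : Fin m)) fun i j hij =>
      Subtype.ext (Fin.ext_iff.1 hij)
  have := hli.finite
  exact not_finite ℕ

end Independence

end IsSkewPrimitive

end Lowering

/-! ### The q-binomial theorem -/

section GaussBinomial

variable {k : Type u} [Field k]

/-- The Gaussian binomial coefficients, as the coefficients of `Yⁱ X^(m - i)` in `(X + Y)ᵐ` when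
`X Y = q Y X`. -/
def gaussBinomial (q : k) : ℕ → ℕ → k
  | _, 0 => 1
  | 0, _ + 1 => 0
  | m + 1, i + 1 => gaussBinomial q m i + q ^ (i + 1) * gaussBinomial q m (i + 1)

lemma gaussBinomial_zero_right (q : k) (m : ℕ) : gaussBinomial q m 0 = 1 := by
  cases m <;> rfl

lemma gaussBinomial_succ_succ (q : k) (m i : ℕ) : gaussBinomial q (m + 1) (i + 1) =
    gaussBinomial q m i + q ^ (i + 1) * gaussBinomial q m (i + 1) := rfl

lemma gaussBinomial_eq_zero (q : k) (m : ℕ) : ∀ i, m < i → gaussBinomial q m i = 0 := by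
  induction m with
  | zero => intro i hi; cases i with
    | zero => omega
    | succ i => rfl
  | succ m ih => intro i hi; cases i with
    | zero => omega
    | succ i => rw [gaussBinomial_succ_succ, ih i (by omega), ih (i + 1) (by omega)]; simp

lemma gaussBinomial_self (q : k) (m : ℕ) : gaussBinomial q m m = 1 := by
  induction m with
  | zero => rfl
  | succ m ih => rw [gaussBinomial_succ_succ, ih, gaussBinomial_eq_zero q m _ (by omega)]; simp

/-- The second Pascal identity. -/
lemma gaussBinomial_succ_succ' (q : k) (m : ℕ) : ∀ i ≤ m, gaussBinomial q (m + 1) (i + 1) =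
    q ^ (m - i) * gaussBinomial q m i + gaussBinomial q m (i + 1) := by
  induction m with
  | zero => intro i hi; obtain rfl : i = 0 := by omega
            simp [gaussBinomial]
  | succ m ih =>
    intro i hi
    rcases Nat.lt_or_eq_of_le hi with hlt | rfl
    · cases i with
      | zero =>
        have h := ih 0 (by omega)
        have h' := gaussBinomial_succ_succ q m 0
        rw [gaussBinomial_succ_succ q (m + 1) 0]
        simp only [gaussBinomial_zero_right, Nat.sub_zero, zero_add, pow_one, mul_one] at h h' ⊢
        linear_combination q * h - h'
      | succ i =>
        have h1 := ih i (by omega)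
        have h2 := ih (i + 1) (by omega)
        have h3 := gaussBinomial_succ_succ q m i
        have h4 := gaussBinomial_succ_succ q m (i + 1)
        have e1 : m + 1 - (i + 1) = m - i := by omega
        have e2 : m - i = m - (i + 1) + 1 := by omega
        rw [gaussBinomial_succ_succ q (m + 1) (i + 1), e1]
        rw [e2] at h1 ⊢
        linear_combination h1 + q ^ (i + 1 + 1) * h2 - q ^ (m - (i + 1) + 1) * h3 - h4
    · rw [gaussBinomial_self, gaussBinomial_self, gaussBinomial_eq_zero q (m + 1) _ (by omega)]
      simp

lemma gaussBinomial_eq_zero_of_isPrimitiveRoot {ζ : k} {n : ℕ} (hζ : IsPrimitiveRoot ζ n) :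
    ∀ i, i + 1 < n → gaussBinomial ζ n (i + 1) = 0 := by
  obtain _ | n := n
  · intro i hi; omega
  -- Comparing the two Pascal identities gives `(ζ^(i+1) - 1) C(n, i+1) = (ζ^(n-i) - 1) C(n, i)`.
  have key : ∀ m i, i ≤ m → (ζ ^ (i + 1) - 1) * gaussBinomial ζ m (i + 1) =
      (ζ ^ (m - i) - 1) * gaussBinomial ζ m i := by
    intro m i hi
    linear_combination gaussBinomial_succ_succ' ζ m i hi - gaussBinomial_succ_succ ζ m i
  intro i
  induction i with
  | zero =>
    intro hi
    have h := key (n + 1) 0 (by omega)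
    rw [Nat.sub_zero, hζ.pow_eq_one, sub_self, zero_mul] at h
    exact (mul_eq_zero.1 h).resolve_left (sub_ne_zero.2 (hζ.pow_ne_one_of_pos_of_lt (by omega) hi))
  | succ i ih =>
    intro hi
    have h := key (n + 1) (i + 1) (by omega)
    rw [ih (by omega), mul_zero] at h
    exact (mul_eq_zero.1 h).resolve_left (sub_ne_zero.2 (hζ.pow_ne_one_of_pos_of_lt (by omega) hi))

variable {A : Type v} [Ring A] [Algebra k A]

lemma mul_pow_of_skewCommute {q : k} {X Y : A} (h : X * Y = q • (Y * X)) (i : ℕ) :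
    X * Y ^ i = q ^ i • (Y ^ i * X) := by
  induction i with
  | zero => simp
  | succ i ih =>
    rw [pow_succ', ← mul_assoc, h, smul_mul_assoc, mul_assoc, ih, mul_smul_comm, smul_smul,
      ← pow_succ', mul_assoc]

/-- The noncommutative `q`-binomial theorem. -/
theorem add_pow_of_skewCommute {q : k} {X Y : A} (h : X * Y = q • (Y * X)) (m : ℕ) :
    (X + Y) ^ m = ∑ i ∈ Finset.range (m + 1), gaussBinomial q m i • (Y ^ i * X ^ (m - i)) := by
  induction m with
  | zero => simp [gaussBinomial]
  | succ m ih =>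
    have hX : X * ∑ i ∈ Finset.range (m + 1), gaussBinomial q m i • (Y ^ i * X ^ (m - i)) =
        ∑ i ∈ Finset.range (m + 1), (q ^ (i + 1) * gaussBinomial q m (i + 1)) •
          (Y ^ (i + 1) * X ^ (m - i)) + X ^ (m + 1) := by
      rw [Finset.sum_range_succ', Finset.sum_range_succ,
        gaussBinomial_eq_zero q m (m + 1) (by omega), mul_zero, zero_smul, add_zero, mul_add,
            Finset.mul_sum, gaussBinomial_zero_right]
      congr 1
      · refine Finset.sum_congr rfl fun i hi => ?_
        have e : m - i = m - (i + 1) + 1 := by have := Finset.mem_range.1 hi; omega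
        rw [mul_smul_comm, ← mul_assoc, mul_pow_of_skewCommute h, smul_mul_assoc, smul_smul, e,
          pow_succ' X, mul_assoc, mul_comm]
      · simp [pow_succ']
    have hY : Y * ∑ i ∈ Finset.range (m + 1), gaussBinomial q m i • (Y ^ i * X ^ (m - i)) =
        ∑ i ∈ Finset.range (m + 1), gaussBinomial q m i • (Y ^ (i + 1) * X ^ (m - i)) := by
      rw [Finset.mul_sum]
      refine Finset.sum_congr rfl fun i _ => ?_
      rw [mul_smul_comm, pow_succ', mul_assoc]
    rw [pow_succ', ih, add_mul, hX, hY, Finset.sum_range_succ' _ (m + 1)]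
    simp only [gaussBinomial_succ_succ, add_smul, Finset.sum_add_distrib, gaussBinomial_zero_right,
      Nat.add_sub_add_right, pow_zero, one_mul, one_smul, Nat.sub_zero]
    abel

theorem add_pow_of_isPrimitiveRoot {ζ : k} {n : ℕ} (hn : 0 < n) (hζ : IsPrimitiveRoot ζ n)
    {X Y : A} (h : X * Y = ζ • (Y * X)) : (X + Y) ^ n = X ^ n + Y ^ n := by
  obtain ⟨n, rfl⟩ := Nat.exists_eq_succ_of_ne_zero hn.ne'
  rw [add_pow_of_skewCommute h, Finset.sum_range_succ, Finset.sum_range_succ']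
  rw [Finset.sum_eq_zero fun i hi => ?_]
  · simp [gaussBinomial_self, gaussBinomial_zero_right]
  · rw [gaussBinomial_eq_zero_of_isPrimitiveRoot hζ i (by have := Finset.mem_range.1 hi; omega),
      zero_smul]

end GaussBinomial

/-! ### Eigenvectors of conjugation by the grouplike -/

section EigenPair

variable {k : Type u} [Field k] {H : Type v} [Ring H] [HopfAlgebra k H]

/-- A nontrivial `(g, 1)`-skew-primitive element `y` with `g y = ζ y g`, for a primitive `n`-th root
of unity `ζ ≠ 1`. -/
structure IsEigenPair (g : GroupLike k H) (y : H) (n : ℕ) (ζ : k) : Prop where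
  isSkewPrimitive : IsSkewPrimitive k g.val 1 y
  notMem : y ∉ groupSpan k H
  two_le : 2 ≤ n
  isPrimitiveRoot : IsPrimitiveRoot ζ n
  mul_eq : g.val * y = ζ • (y * g.val)

namespace IsEigenPair

variable {g : GroupLike k H} {y : H} {n : ℕ} {ζ : k}

lemma ne_one (h : IsEigenPair g y n ζ) : ζ ≠ 1 :=
  h.isPrimitiveRoot.ne_one h.two_le

lemma pow_isSkewPrimitive (h : IsEigenPair g y n ζ) : IsSkewPrimitive k (g ^ n).val 1 (y ^ n) := by
  refine ⟨(g ^ n).2, .one, ?_⟩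
  have hcomm : (g.val ⊗ₜ[k] y) * (y ⊗ₜ[k] (1 : H)) =
      ζ • ((y ⊗ₜ[k] (1 : H)) * (g.val ⊗ₜ[k] y)) := by
    simp [h.mul_eq, TensorProduct.smul_tmul']
  rw [Bialgebra.comul_pow, h.isSkewPrimitive.comul_eq,
    add_pow_of_isPrimitiveRoot (by have := h.two_le; omega) h.isPrimitiveRoot hcomm]
  simp [Algebra.TensorProduct.tmul_pow]

/-- The order of `g` is a multiple of `n`. -/
lemma dvd_of_pow_eq_one (h : IsEigenPair g y n ζ) {m : ℕ} (hm : g ^ m = 1) : n ∣ m := by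
  have h1 := IsSkewPrimitive.groupLike_pow_mul h.mul_eq m
  rw [← GroupLike.val_pow, hm, GroupLike.val_one, one_mul, mul_one] at h1
  apply h.isPrimitiveRoot.dvd_of_pow_eq_one
  by_contra hne
  have h2 : (ζ ^ m - 1) • y = 0 := by rw [sub_smul, ← h1, one_smul, sub_self]
  have h3 := (smul_eq_zero.1 h2).resolve_left (sub_ne_zero.2 hne)
  exact h.notMem (h3 ▸ Submodule.zero_mem _)

lemma sum_pow_ne_zero (h : IsEigenPair g y n ζ) (j : ℕ) (hj : j + 1 < n) :
    ∑ s ∈ Finset.range (j + 1), ζ ^ s ≠ 0 := by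
  intro h0
  have := mul_geom_sum ζ (j + 1)
  rw [h0, mul_zero, eq_comm, sub_eq_zero] at this
  exact h.isPrimitiveRoot.pow_ne_one_of_pos_of_lt (by omega) hj this

variable [FiniteDimensional k H]

lemma exists_pow_eq_smul (h : IsEigenPair g y n ζ) (hp : IsPointed k H) (hr : HasRank k H 1) :
    ∃ c : k, y ^ n = c • ((g ^ n).val - 1) := by
  refine h.pow_isSkewPrimitive.eq_smul_of_mem_groupSpan ?_
  by_contra hn
  have hg := hr.groupLike_eq hp h.isSkewPrimitive h.notMem h.pow_isSkewPrimitive hn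
  have h2 := h.two_le
  have : g ^ (n - 1) = 1 := by
    have h1 : g ^ (n - 1) * g = 1 * g := by
      rw [← pow_succ, Nat.sub_add_cancel (by omega), hg, one_mul]
    exact mul_right_cancel h1
  have := Nat.le_of_dvd (by omega) (h.dvd_of_pow_eq_one this)
  omega

/-- The group of grouplikes acts on `y` by a character. -/
lemma exists_character (h : IsEigenPair g y n ζ) (hp : IsPointed k H) (hr : HasRank k H 1)
    (hg : g ∈ Subgroup.center (GroupLike k H)) :
    ∃ χ : GroupLike k H →* k, ∀ a : GroupLike k H, a.val * y = χ a • (y * a.val) := by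
  have hex : ∀ a : GroupLike k H, ∃ c : k, a.val * y = c • (y * a.val) := by
    intro a
    obtain ⟨-, β, γ, hβγ⟩ := hr.conj_eq hp h.isSkewPrimitive h.notMem a
    have h1 : a.val * y = β • (y * a.val) + γ • ((g.val - 1) * a.val) := by
      rw [← smul_mul_assoc, ← smul_mul_assoc, ← add_mul, ← hβγ, mul_assoc, val_inv_mul_val,
        mul_one]
    have hga : g.val * a.val = a.val * g.val := by
      rw [← GroupLike.val_mul, ← GroupLike.val_mul, Subgroup.mem_center_iff.1 hg a]
    -- As `g` is central, both `a y a⁻¹` and `y` are `ζ`-eigenvectors for conjugation by `g`,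
    -- while `g - 1` commutes with `g`.
    have h2 : g.val * (a.val * y) = ζ • ((a.val * y) * g.val) := by
      rw [← mul_assoc, hga, mul_assoc, h.mul_eq, mul_smul_comm, mul_assoc]
    rw [h1, mul_add, mul_smul_comm, mul_smul_comm, ← mul_assoc, h.mul_eq, smul_mul_assoc,
      mul_assoc, hga, add_mul, smul_add, smul_mul_assoc, smul_mul_assoc, smul_comm ζ β, mul_assoc,
      add_right_inj] at h2
    have h3 : g.val * ((g.val - 1) * a.val) = (g.val - 1) * a.val * g.val := by
      rw [mul_assoc, ← hga, ← mul_assoc, ← mul_assoc]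
      congr 1
      rw [mul_sub, sub_mul, mul_one, one_mul]
    have h4 : ((1 - ζ) * γ) • ((g.val - 1) * a.val * g.val) = 0 := by
      rw [mul_smul, sub_smul, one_smul, ← h2, h3, sub_self]
    have h5 : γ • ((g.val - 1) * a.val * g.val) = 0 := by
      rw [mul_smul] at h4
      exact (smul_eq_zero.1 h4).resolve_left (sub_ne_zero.2 (Ne.symm h.ne_one))
    have h6 : γ • ((g.val - 1) * a.val) = 0 := by
      have := congrArg (· * (g⁻¹).val) h5
      simpa only [smul_mul_assoc, mul_assoc, val_mul_val_inv, mul_one, zero_mul] using this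
    exact ⟨β, by rw [h1, h6, add_zero]⟩
  choose χ hχ using hex
  have hne : ∀ a : GroupLike k H, y * a.val ≠ 0 := by
    intro a h0
    apply h.notMem
    rw [← mul_groupLike_mem_groupSpan_iff a, h0]
    exact Submodule.zero_mem _
  have huniq : ∀ (a : GroupLike k H) (c : k), a.val * y = c • (y * a.val) → χ a = c := by
    intro a c hc
    rw [hχ a, ← sub_eq_zero, ← sub_smul] at hc
    exact sub_eq_zero.1 ((smul_eq_zero.1 hc).resolve_right (hne a))
  refine ⟨⟨⟨χ, huniq 1 1 (by simp)⟩, fun a b => huniq _ _ ?_⟩, hχ⟩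
  rw [GroupLike.val_mul, mul_assoc, hχ b, mul_smul_comm, ← mul_assoc, hχ a, smul_mul_assoc,
    smul_smul, mul_assoc, mul_comm (χ a)]

end IsEigenPair

/-- Every nontrivial skew-primitive element of a rank one Hopf algebra becomes an eigenvector of
conjugation by `g`, with an eigenvalue other than `1`, after adding a multiple of `g - 1`. -/
theorem HasRank.exists_isEigenPair [CharZero k] [FiniteDimensional k H]
    (hp : IsPointed k H) (hr : HasRank k H 1) {g : GroupLike k H} {x : H}
    (hx : IsSkewPrimitive k g.val 1 x) (hxn : x ∉ groupSpan k H) :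
    ∃ (n : ℕ) (ζ c : k), IsEigenPair g (x + c • (g.val - 1)) n ζ := by
  classical
  have := finite_groupLike (k := k) (C := H)
  have := Fintype.ofFinite (GroupLike k H)
  obtain ⟨-, β, γ, hβγ⟩ := hr.conj_eq hp hx hxn g
  have h1 : g.val * x = (β • x + γ • (g.val - 1)) * g.val := by
    rw [← hβγ, mul_assoc, val_inv_mul_val, mul_one]
  have hgpos : 0 < orderOf g := orderOf_pos g
  have hgN : g.val ^ orderOf g = 1 := by
    rw [← GroupLike.val_pow, pow_orderOf_eq_one, GroupLike.val_one]
  have hgg : g.val * (g.val - 1) = (g.val - 1) * g.val := by rw [mul_sub, sub_mul]; simp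
  have hβN : β ^ orderOf g = 1 := by
    have hmod : ∀ m : ℕ, ∃ s : k, g.val ^ m * x = (β ^ m • x + s • (g.val - 1)) * g.val ^ m := by
      intro m
      induction m with
      | zero => exact ⟨0, by simp⟩
      | succ m ih =>
        obtain ⟨s, hs⟩ := ih
        refine ⟨β ^ m * γ + s, ?_⟩
        have e : g.val * (β ^ m • x + s • (g.val - 1)) =
            (β ^ (m + 1) • x + (β ^ m * γ + s) • (g.val - 1)) * g.val := by
          rw [mul_add, mul_smul_comm, mul_smul_comm, h1, hgg, ← smul_mul_assoc, ← smul_mul_assoc,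
            ← add_mul]
          congr 1
          module
        rw [pow_succ', mul_assoc, hs, ← mul_assoc, e, mul_assoc]
    obtain ⟨s, hs⟩ := hmod (orderOf g)
    rw [hgN, one_mul, mul_one] at hs
    by_contra hne
    apply hxn
    rw [← Submodule.smul_mem_iff _ (sub_ne_zero.2 (Ne.symm hne)), sub_smul, one_smul]
    nth_rw 1 [hs]
    rw [add_sub_cancel_left]
    exact Submodule.smul_mem _ _ (Submodule.sub_mem _ (groupLike_mem_groupSpan g) one_mem_groupSpan)
  have hβ1 : β ≠ 1 := by
    rintro rfl
    have hmod : ∀ m : ℕ, g.val ^ m * x = (x + (m * γ : k) • (g.val - 1)) * g.val ^ m := by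
      intro m
      induction m with
      | zero => simp
      | succ m ih =>
        have e : g.val * (x + (m * γ : k) • (g.val - 1)) =
            (x + ((m + 1 : ℕ) * γ : k) • (g.val - 1)) * g.val := by
          rw [mul_add, mul_smul_comm, h1, hgg, ← smul_mul_assoc, ← add_mul]
          congr 1
          push_cast
          module
        rw [pow_succ', mul_assoc, ih, ← mul_assoc, e, mul_assoc]
    have hN := hmod (orderOf g)
    rw [hgN, one_mul, mul_one, left_eq_add, mul_smul] at hN
    have hγ := (smul_eq_zero.1 hN).resolve_left (by exact_mod_cast hgpos.ne')
    rw [hγ, one_smul, add_zero] at h1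
    exact hxn (hx.mem_groupSpan_of_commute h1)
  have hc : γ + γ / (β - 1) = β * (γ / (β - 1)) := by
    field_simp [sub_ne_zero.2 hβ1]
    ring
  have hn0 : orderOf β ≠ 0 := (orderOf_pos_iff.2 (isOfFinOrder_iff_pow_eq_one.2 ⟨_, hgpos,
      hβN⟩)).ne'
  have hn1 : orderOf β ≠ 1 := fun h => hβ1 (orderOf_eq_one_iff.1 h)
  refine ⟨orderOf β, β, γ / (β - 1), ?_, ?_, by omega, IsPrimitiveRoot.orderOf β, ?_⟩
  · simpa using hx.add_smul (IsSkewPrimitive.sub_one g) 1 (γ / (β - 1))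
  · rwa [Submodule.add_mem_iff_left _ (Submodule.smul_mem _ _ (Submodule.sub_mem _
      (groupLike_mem_groupSpan g) one_mem_groupSpan))]
  · rw [mul_add, mul_smul_comm, h1, hgg, ← smul_mul_assoc, ← smul_mul_assoc, ← add_mul]
    congr 1
    rw [add_assoc, ← add_smul, hc]
    module

end EigenPair

/-! ### Taft algebras -/

section Taft

variable {k : Type u} [Field k]

namespace TaftAlgebra

variable (n : ℕ) (ζ : k)

lemma gen_g_pow : gen n ζ TaftGen.g ^ n = 1 := by
  rw [gen, ← map_pow, RingQuot.mkAlgHom_rel k (TaftRel.g_pow (n := n) (ζ := ζ)), map_one]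

lemma gen_x_pow : gen n ζ TaftGen.x ^ n = 0 := by
  rw [gen, ← map_pow, RingQuot.mkAlgHom_rel k (TaftRel.x_pow (n := n) (ζ := ζ)), map_zero]

lemma gen_g_mul_gen_x :
    gen n ζ TaftGen.g * gen n ζ TaftGen.x = ζ • (gen n ζ TaftGen.x * gen n ζ TaftGen.g) := by
  rw [gen, gen, ← map_mul, RingQuot.mkAlgHom_rel k (TaftRel.g_mul_x (n := n) (ζ := ζ)), map_smul,
    map_mul]

variable {n ζ}

lemma algHom_mem_adjoin {B : Type*} [Ring B] [Algebra k B] (F : TaftAlgebra k n ζ →ₐ[k] B)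
    (t : TaftAlgebra k n ζ) :
    F t ∈ Algebra.adjoin k {F (gen n ζ TaftGen.g), F (gen n ζ TaftGen.x)} := by
  obtain ⟨f, rfl⟩ := RingQuot.mkAlgHom_surjective k (TaftRel k n ζ) t
  induction f using FreeAlgebra.induction with
  | grade0 r =>
    rw [AlgHom.commutes, AlgHom.commutes]
    exact Subalgebra.algebraMap_mem _ r
  | grade1 s =>
    cases s with
    | g => exact Algebra.subset_adjoin (Set.mem_insert _ _)
    | x => exact Algebra.subset_adjoin (Set.mem_insert_of_mem _ rfl)
  | mul a b ha hb => rw [map_mul, map_mul]; exact Subalgebra.mul_mem _ ha hb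
  | add a b ha hb => rw [map_add, map_add]; exact Subalgebra.add_mem _ ha hb

/-- The monomials `xⁱ gʲ` with `i, j < n` span the Taft algebra. -/
lemma span_monomials_eq_top (hn : 0 < n) :
    Submodule.span k (Set.range fun p : Fin n × Fin n =>
      gen n ζ TaftGen.x ^ (p.1 : ℕ) * gen n ζ TaftGen.g ^ (p.2 : ℕ)) = ⊤ := by
  set X := gen n ζ TaftGen.x with hX
  set G := gen n ζ TaftGen.g with hG
  set S := Submodule.span k (Set.range fun p : Fin n × Fin n => X ^ (p.1 : ℕ) * G ^ (p.2 : ℕ))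
    with hS
  have hGn : G ^ n = 1 := gen_g_pow n ζ
  have hXn : X ^ n = 0 := gen_x_pow n ζ
  have hmem : ∀ i j : ℕ, i ≤ n → j ≤ n → X ^ i * G ^ j ∈ S := by
    intro i j hi hj
    rcases hi.eq_or_lt with rfl | hi
    · rw [hXn, zero_mul]; exact S.zero_mem
    rcases hj.eq_or_lt with rfl | hj
    · rw [hGn]
      exact Submodule.subset_span ⟨(⟨i, hi⟩, ⟨0, hn⟩), by simp⟩
    · exact Submodule.subset_span ⟨(⟨i, hi⟩, ⟨j, hj⟩), rfl⟩
  have hXS : ∀ s ∈ S, X * s ∈ S := by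
    intro s hs
    induction hs using Submodule.span_induction with
    | mem y hy =>
      obtain ⟨⟨i, j⟩, rfl⟩ := hy
      dsimp only
      rw [← mul_assoc, ← pow_succ']
      exact hmem _ _ i.2 j.2.le
    | zero => simp
    | add y z _ _ hy hz => rw [mul_add]; exact S.add_mem hy hz
    | smul c y _ hy => rw [mul_smul_comm]; exact S.smul_mem _ hy
  have hGS : ∀ s ∈ S, G * s ∈ S := by
    intro s hs
    induction hs using Submodule.span_induction with
    | mem y hy =>
      obtain ⟨⟨i, j⟩, rfl⟩ := hy
      dsimp only
      rw [← mul_assoc, mul_pow_of_skewCommute (gen_g_mul_gen_x n ζ), smul_mul_assoc, mul_assoc,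
        ← pow_succ']
      exact S.smul_mem _ (hmem _ _ i.2.le j.2)
    | zero => simp
    | add y z _ _ hy hz => rw [mul_add]; exact S.add_mem hy hz
    | smul c y _ hy => rw [mul_smul_comm]; exact S.smul_mem _ hy
  have hall : ∀ t ∈ Algebra.adjoin k {G, X}, ∀ s ∈ S, t * s ∈ S := by
    intro t ht
    induction ht using Algebra.adjoin_induction with
    | mem y hy =>
      rcases hy with rfl | rfl
      · exact hGS
      · exact hXS
    | algebraMap r => intro s hs; rw [← Algebra.smul_def]; exact S.smul_mem _ hs
    | add a b _ _ ha hb => intro s hs; rw [add_mul]; exact S.add_mem (ha s hs) (hb s hs)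
    | mul a b _ _ ha hb => intro s hs; rw [mul_assoc]; exact ha _ (hb s hs)
  rw [eq_top_iff]
  intro t _
  have := hall t (algHom_mem_adjoin (AlgHom.id k _) t) 1 (by simpa using hmem 0 0 hn.le hn.le)
  rwa [mul_one] at this

end TaftAlgebra

variable {H : Type v} [Ring H] [HopfAlgebra k H]

lemma adjoin_pair_le {g x y : H} {β c : k} (hy : y = β • x + c • (g - 1)) :
    Algebra.adjoin k {g, y} ≤ Algebra.adjoin k {g, x} := by
  have hg : g ∈ Algebra.adjoin k {g, x} := Algebra.subset_adjoin (Set.mem_insert _ _)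
  have hx : x ∈ Algebra.adjoin k {g, x} := Algebra.subset_adjoin (Set.mem_insert_of_mem _ rfl)
  refine Algebra.adjoin_le ?_
  rintro z (rfl | rfl)
  · exact hg
  · rw [SetLike.mem_coe, hy]
    exact Subalgebra.add_mem _ (Subalgebra.smul_mem _ hx _)
      (Subalgebra.smul_mem _ (Subalgebra.sub_mem _ hg (Subalgebra.one_mem _)) _)

lemma adjoin_pair_eq {g x y : H} {β c : k} (hβ : β ≠ 0) (hy : y = β • x + c • (g - 1)) :
    Algebra.adjoin k {g, y} = Algebra.adjoin k {g, x} := by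
  refine le_antisymm (adjoin_pair_le hy) (adjoin_pair_le (β := β⁻¹) (c := -(β⁻¹ * c)) ?_)
  rw [hy, smul_add, smul_smul, inv_mul_cancel₀ hβ, one_smul, smul_smul, neg_smul,
    add_neg_cancel_right]

namespace IsEigenPair

variable {g : GroupLike k H} {y : H} {n : ℕ} {ζ : k}

lemma linearIndependent_pow_mul [Finite (GroupLike k H)] (h : IsEigenPair g y n ζ) :
    LinearIndependent k fun p : Fin n × GroupLike k H => y ^ (p.1 : ℕ) * p.2.val := by
  classical
  have := Fintype.ofFinite (GroupLike k H)
  rw [Fintype.linearIndependent_iff]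
  rintro c hc ⟨i, a⟩
  have := h.isSkewPrimitive.pow_mul_coeff_eq_zero h.notMem h.mul_eq n h.sum_pow_ne_zero
    (fun i a => if hi : i < n then c (⟨i, hi⟩, a) else 0)
    (by
      rw [Finset.sum_range, ← hc, Fintype.sum_prod_type]
      simp) i i.2 a
  simpa using this

lemma orderOf_eq (h : IsEigenPair g y n ζ) (hgn : g ^ n = 1) : orderOf g = n :=
  Nat.dvd_antisymm (orderOf_dvd_of_pow_eq_one hgn) (h.dvd_of_pow_eq_one (pow_orderOf_eq_one g))

/-- The algebra generated by `g` and `y` is a Taft algebra as soon as the Taft relations hold. -/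
theorem isTaft [FiniteDimensional k H] (h : IsEigenPair g y n ζ) (hgn : g ^ n = 1)
    (hyn : y ^ n = 0) : IsTaft (Algebra.adjoin k {g.val, y}) n ζ := by
  have := finite_groupLike (k := k) (C := H)
  have hgn' : g.val ^ n = 1 := by rw [← GroupLike.val_pow, hgn, GroupLike.val_one]
  let f : FreeAlgebra k TaftGen →ₐ[k] H := FreeAlgebra.lift k fun t => TaftGen.casesOn t g.val y
  have hfg : f (FreeAlgebra.ι k TaftGen.g) = g.val := FreeAlgebra.lift_ι_apply _ _
  have hfx : f (FreeAlgebra.ι k TaftGen.x) = y := FreeAlgebra.lift_ι_apply _ _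
  have hrel : ∀ ⦃a b : FreeAlgebra k TaftGen⦄, TaftRel k n ζ a b → f a = f b := by
    rintro _ _ (_ | _ | _)
    · rw [map_pow, hfg, hgn', map_one]
    · rw [map_pow, hfx, hyn, map_zero]
    · rw [map_smul, map_mul, map_mul, hfg, hfx, h.mul_eq]
  let F : TaftAlgebra k n ζ →ₐ[k] H := RingQuot.liftAlgHom k ⟨f, hrel⟩
  have hFg : F (TaftAlgebra.gen n ζ TaftGen.g) = g.val := by
    rw [TaftAlgebra.gen, RingQuot.liftAlgHom_mkAlgHom_apply, hfg]
  have hFx : F (TaftAlgebra.gen n ζ TaftGen.x) = y := by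
    rw [TaftAlgebra.gen, RingQuot.liftAlgHom_mkAlgHom_apply, hfx]
  have hinj : Function.Injective F := by
    rw [injective_iff_map_eq_zero]
    intro t ht
    have hmem : t ∈ Submodule.span k (Set.range fun p : Fin n × Fin n =>
        TaftAlgebra.gen n ζ TaftGen.x ^ (p.1 : ℕ) * TaftAlgebra.gen n ζ TaftGen.g ^ (p.2 : ℕ)) := by
      rw [TaftAlgebra.span_monomials_eq_top (by have := h.two_le; omega)]; trivial
    obtain ⟨c, rfl⟩ := (Submodule.mem_span_range_iff_exists_fun k).1 hmem
    have hinj : Function.Injective fun p : Fin n × Fin n => (p.1, g ^ (p.2 : ℕ)) := by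
      rintro ⟨i, j⟩ ⟨i', j'⟩ hij
      have h1 := (Prod.ext_iff.1 hij).1
      have h2 : g ^ (j : ℕ) = g ^ (j' : ℕ) := (Prod.ext_iff.1 hij).2
      have h3 := pow_injOn_Iio_orderOf (x := g) (by rw [h.orderOf_eq hgn]; exact j.2)
        (by rw [h.orderOf_eq hgn]; exact j'.2) h2
      exact Prod.ext h1 (Fin.ext h3)
    have hli := Fintype.linearIndependent_iff.1 (h.linearIndependent_pow_mul.comp _ hinj) c ?_
    · simp [hli]
    · rw [map_sum] at ht
      simpa only [map_smul, map_mul, map_pow, hFg, hFx, Function.comp_def,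
        GroupLike.val_pow] using ht
  have hrange : F.range = Algebra.adjoin k {g.val, y} := by
    apply le_antisymm
    · rintro _ ⟨t, rfl⟩
      have := TaftAlgebra.algHom_mem_adjoin F t
      rwa [hFg, hFx] at this
    · refine Algebra.adjoin_le ?_
      rintro z (rfl | rfl)
      · exact ⟨_, hFg⟩
      · exact ⟨_, hFx⟩
  refine ⟨h.two_le, h.isPrimitiveRoot,
    (AlgEquiv.ofInjective F hinj).trans (Subalgebra.equivOfEq _ _ hrange), ?_⟩
  change IsSkewPrimitive k (F (TaftAlgebra.gen n ζ TaftGen.g)) 1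
    (F (TaftAlgebra.gen n ζ TaftGen.x))
  rw [hFg, hFx]
  exact h.isSkewPrimitive

end IsEigenPair

/-- If the Hopf subalgebra generated by `g` and `x` is a Taft algebra, its Taft generators are `g`
itself and a combination of `x` and `g - 1`. -/
theorem IsTaft.exists_isEigenPair [FiniteDimensional k H] (hp : IsPointed k H)
    (hr : HasRank k H 1) {g : GroupLike k H} {x : H} (hx : IsSkewPrimitive k g.val 1 x)
    (hxn : x ∉ groupSpan k H) {n : ℕ} {ζ : k}
    (hT : IsTaft (Algebra.adjoin k {g.val, x}) n ζ) :
    ∃ β c : k, β ≠ 0 ∧ IsEigenPair g (β • x + c • (g.val - 1)) n ζ ∧ g ^ n = 1 ∧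
      (β • x + c • (g.val - 1)) ^ n = 0 := by
  obtain ⟨hn, hζ, e, he⟩ := hT
  let F : TaftAlgebra k n ζ →ₐ[k] H := (Algebra.adjoin k {g.val, x}).val.comp e.toAlgHom
  change IsSkewPrimitive k (F (TaftAlgebra.gen n ζ TaftGen.g)) 1
    (F (TaftAlgebra.gen n ζ TaftGen.x)) at he
  have hF := TaftAlgebra.algHom_mem_adjoin F
  have hgn : F (TaftAlgebra.gen n ζ TaftGen.g) ^ n = 1 := by
    rw [← map_pow, TaftAlgebra.gen_g_pow, map_one]
  have hyn : F (TaftAlgebra.gen n ζ TaftGen.x) ^ n = 0 := by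
    rw [← map_pow, TaftAlgebra.gen_x_pow, map_zero]
  have hcomm : F (TaftAlgebra.gen n ζ TaftGen.g) * F (TaftAlgebra.gen n ζ TaftGen.x) =
      ζ • (F (TaftAlgebra.gen n ζ TaftGen.x) * F (TaftAlgebra.gen n ζ TaftGen.g)) := by
    rw [← map_mul, TaftAlgebra.gen_g_mul_gen_x, map_smul, map_mul]
  have hxF : F (e.symm ⟨x, Algebra.subset_adjoin (Set.mem_insert_of_mem _ rfl)⟩) = x :=
    congrArg Subtype.val (e.apply_symm_apply _)
  generalize F (TaftAlgebra.gen n ζ TaftGen.g) = γ at *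
  generalize F (TaftAlgebra.gen n ζ TaftGen.x) = y at *
  obtain ⟨γ, rfl⟩ : ∃ a : GroupLike k H, a.val = γ := ⟨⟨γ, he.left⟩, rfl⟩
  have hyn' : y ∉ groupSpan k H := by
    intro hy
    refine hxn (hxF ▸ adjoin_le_groupSpan ?_ (hF _))
    rintro z (rfl | rfl)
    · exact groupLike_mem_groupSpan γ
    · exact hy
  obtain rfl := hr.groupLike_eq hp hx hxn he hyn'
  obtain ⟨β, c, rfl⟩ := hr.exists_eq_smul_add hp hx hxn he
  refine ⟨β, c, ?_, ⟨he, hyn', hn, hζ, hcomm⟩, ?_, hyn⟩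
  · rintro rfl
    apply hyn'
    rw [zero_smul, zero_add]
    exact Submodule.smul_mem _ _ (Submodule.sub_mem _ (groupLike_mem_groupSpan _)
      one_mem_groupSpan)
  · exact GroupLike.val_injective (by rw [GroupLike.val_pow, hgn, GroupLike.val_one])

end Taft

/-! ### Twisted difference operators on a field -/

section TwistedDifference

variable {k : Type u} [Field k] {L : Type w} [Field L] [Algebra k L]

/-- The operator `l ↦ v (l - σ l)`. -/
noncomputable def twistedDifference (σ : L ≃ₐ[k] L) (v : L) : Module.End k L :=
  LinearMap.mulLeft k v * (1 - σ.toLinearMap)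

lemma twistedDifference_apply (σ : L ≃ₐ[k] L) (v l : L) :
    twistedDifference σ v l = v * (l - σ l) := by
  simp [twistedDifference]

open Polynomial in
lemma prod_one_sub_eq {ζ : k} {n : ℕ} (hn : 0 < n) (hζ : IsPrimitiveRoot ζ n) :
    ∏ s ∈ Finset.range n, (1 - C (ζ ^ s) * X : k[X]) = 1 - X ^ n := by
  have h' : IsPrimitiveRoot (C ζ) n := hζ.map_of_injective C_injective
  have h := h'.pow_sub_pow_eq_prod_sub_mul (1 : k[X]) X hn
  rw [one_pow] at h
  classical
  rw [h, Finset.prod_eq_multiset_prod, Finset.prod_eq_multiset_prod, nthRootsFinset_def,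
    Multiset.toFinset_val, h'.nthRoots_one_nodup.dedup, h'.nthRoots_eq (one_pow n)]
  simp

open Polynomial in
/-- If `σ v = ζ v`, then `(v (1 - σ))ᵐ = vᵐ ∏_{s < m} (1 - ζˢ σ)`. -/
lemma twistedDifference_pow {σ : L ≃ₐ[k] L} {v : L} {ζ : k} (hv : σ v = ζ • v) (m : ℕ) :
    twistedDifference σ v ^ m = LinearMap.mulLeft k (v ^ m) *
      aeval σ.toLinearMap (∏ s ∈ Finset.range m, (1 - C (ζ ^ s) * X : k[X])) := by
  induction m with
  | zero =>
    ext l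
    simp
  | succ m ih =>
    rw [pow_succ', ih, Finset.prod_range_succ_comm, map_mul, ← mul_assoc, ← mul_assoc]
    congr 1
    ext l
    have hC : aeval σ.toLinearMap (C (ζ ^ m) * X : k[X]) l = ζ ^ m • σ l := by
      rw [map_mul, aeval_C, aeval_X, Module.End.mul_apply, Module.algebraMap_end_apply,
        AlgEquiv.toLinearMap_apply]
    have hvm : σ (v ^ m) = ζ ^ m • v ^ m := by rw [map_pow, hv, _root_.smul_pow]
    rw [Module.End.mul_apply, Module.End.mul_apply, twistedDifference_apply, map_sub, map_one,
      LinearMap.sub_apply, hC, Module.End.one_apply, LinearMap.mulLeft_apply,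
      LinearMap.mulLeft_apply, map_mul, hvm, smul_mul_assoc, pow_succ, Algebra.smul_def,
      Algebra.smul_def]
    ring

/-- If `σ v = ζ v` with `ζ` a primitive `n`-th root of unity, then `(v (1 - σ))ⁿ = vⁿ (1 - σⁿ)`. -/
lemma twistedDifference_pow_eq {σ : L ≃ₐ[k] L} {v : L} {ζ : k} {n : ℕ} (hn : 0 < n)
    (hζ : IsPrimitiveRoot ζ n) (hv : σ v = ζ • v) (l : L) :
    (twistedDifference σ v ^ n) l = v ^ n * (l - (σ ^ n) l) := by
  have hpow : ∀ m : ℕ, (σ.toLinearMap ^ m) l = (σ ^ m) l := by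
    intro m
    rw [Module.End.pow_apply, AlgEquiv.coe_pow]
    rfl
  rw [twistedDifference_pow hv, prod_one_sub_eq hn hζ]
  simp [hpow]

end TwistedDifference

/-! ### Actions on fields -/

namespace HopfAction

section

variable {k : Type u} [Field k] {H : Type v} [Ring H] [HopfAlgebra k H]
  {A : Type w} [CommRing A] [Algebra k A] (ρ : HopfAction k H A)

lemma groupLike_mul (a : GroupLike k H) (l m : A) :
    ρ.toEnd a.val (l * m) = ρ.toEnd a.val l * ρ.toEnd a.val m := by
  rw [ρ.map_mul, a.2.comul_eq_tmul_self]
  simp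

lemma groupLike_one (a : GroupLike k H) : ρ.toEnd a.val 1 = 1 := by
  rw [ρ.map_one, a.2.counit_eq_one, _root_.map_one]

lemma skewPrimitive_mul {g : GroupLike k H} {x : H} (hx : IsSkewPrimitive k g.val 1 x) (l m : A) :
    ρ.toEnd x (l * m) = ρ.toEnd g.val l * ρ.toEnd x m + ρ.toEnd x l * m := by
  rw [ρ.map_mul, hx.comul_eq]
  simp

/-- The algebra endomorphism by which a grouplike element acts. -/
def groupLikeHom (a : GroupLike k H) : A →ₐ[k] A :=
  AlgHom.ofLinearMap (ρ.toEnd a.val) (ρ.groupLike_one a) (ρ.groupLike_mul a)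

/-- The action of the group of grouplikes by algebra automorphisms. -/
def groupLikeAut : GroupLike k H →* (A ≃ₐ[k] A) where
  toFun a := AlgEquiv.ofAlgHom (ρ.groupLikeHom a) (ρ.groupLikeHom a⁻¹)
    (by
      ext l
      change ρ.toEnd a.val (ρ.toEnd (a⁻¹).val l) = l
      rw [← Module.End.mul_apply, ← _root_.map_mul, val_mul_val_inv, _root_.map_one,
        Module.End.one_apply])
    (by
      ext l
      change ρ.toEnd (a⁻¹).val (ρ.toEnd a.val l) = l
      rw [← Module.End.mul_apply, ← _root_.map_mul, val_inv_mul_val, _root_.map_one,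
        Module.End.one_apply])
  map_one' := by
    ext l
    change ρ.toEnd (1 : GroupLike k H).val l = l
    rw [GroupLike.val_one, _root_.map_one, Module.End.one_apply]
  map_mul' a b := by
    ext l
    change ρ.toEnd (a * b).val l = ρ.toEnd a.val (ρ.toEnd b.val l)
    rw [GroupLike.val_mul, _root_.map_mul, Module.End.mul_apply]

lemma groupLikeAut_apply (a : GroupLike k H) (l : A) : ρ.groupLikeAut a l = ρ.toEnd a.val l := rfl

lemma mem_invariants_adjoin {s : Set H} {l : A} : l ∈ ρ.invariants (Algebra.adjoin k s) ↔
    ∀ h ∈ s, ρ.toEnd h l = Coalgebra.counit (R := k) h • l := by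
  refine ⟨fun hl h hh => hl h (Algebra.subset_adjoin hh), fun hs h hh => ?_⟩
  induction hh using Algebra.adjoin_induction with
  | mem h hh => exact hs h hh
  | algebraMap r => simp [Bialgebra.counit_algebraMap]
  | add a b _ _ ha hb => rw [map_add, LinearMap.add_apply, ha, hb, map_add, add_smul]
  | mul a b _ _ ha hb =>
    rw [_root_.map_mul, Module.End.mul_apply, hb, map_smul, ha, smul_smul, Bialgebra.counit_mul,
      mul_comm]

variable {ρ}

/-- The two-sided ideal generated by a skew-primitive element is a Hopf ideal, so in an inner
faithful action nonzero skew-primitive elements act by nonzero operators. -/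
theorem IsInnerFaithful.eq_zero_of_toEnd_eq_zero (hρ : ρ.IsInnerFaithful) {g : GroupLike k H}
    {w : H} (hw : IsSkewPrimitive k g.val 1 w) (h0 : ρ.toEnd w = 0) : w = 0 := by
  set I : Ideal H := (TwoSidedIdeal.span {w}).asIdeal with hI
  have hwI : w ∈ I := by
    rw [hI, TwoSidedIdeal.mem_asIdeal]
    exact TwoSidedIdeal.subset_span rfl
  have hind : ∀ p : H → Prop, p w → p 0 → (∀ x y, p x → p y → p (x + y)) → (∀ x, p x → p (-x)) →
      (∀ a x, p x → p (a * x)) → (∀ b x, p x → p (x * b)) → ∀ z ∈ I, p z := by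
    intro p hpw hp0 hadd hneg hleft hright z hz
    rw [hI, TwoSidedIdeal.mem_asIdeal] at hz
    induction hz using TwoSidedIdeal.span_induction with
    | mem x hx => rw [Set.mem_singleton_iff.1 hx]; exact hpw
    | zero => exact hp0
    | add x y _ _ hx hy => exact hadd x y hx hy
    | neg x _ hx => exact hneg x hx
    | left_absorb a x _ hx => exact hleft a x hx
    | right_absorb b x _ hx => exact hright b x hx
  let Ψ := Algebra.TensorProduct.map (Ideal.Quotient.mkₐ k I) (Ideal.Quotient.mkₐ k I)
  have hΨw : Ψ (Coalgebra.comul w) = 0 := by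
    have hmk : Ideal.Quotient.mkₐ k I w = 0 := Ideal.Quotient.eq_zero_iff_mem.2 hwI
    rw [hw.comul_eq, map_add, Algebra.TensorProduct.map_tmul, Algebra.TensorProduct.map_tmul, hmk,
      TensorProduct.tmul_zero, TensorProduct.zero_tmul, add_zero]
  have hΨ : ∀ z ∈ I, Ψ (Coalgebra.comul z) = 0 := by
    apply hind
    · exact hΨw
    · simp
    · intro x y hx hy; rw [map_add, map_add, hx, hy, add_zero]
    · intro x hx; rw [map_neg, map_neg, hx, neg_zero]
    · intro a x hx; rw [Bialgebra.comul_mul, _root_.map_mul, hx, mul_zero]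
    · intro a x hx; rw [Bialgebra.comul_mul, _root_.map_mul, hx, zero_mul]
  have hε : ∀ z ∈ I, Coalgebra.counit (R := k) z = 0 := by
    apply hind
    · exact hw.counit_eq_zero
    · simp
    · intro x y hx hy; rw [map_add, hx, hy, add_zero]
    · intro x hx; rw [map_neg, hx, neg_zero]
    · intro a x hx; rw [Bialgebra.counit_mul, hx, mul_zero]
    · intro a x hx; rw [Bialgebra.counit_mul, hx, zero_mul]
  have hSw : HopfAlgebra.antipode k w ∈ I := by
    have h := HopfAlgebra.mul_antipode_rTensor_comul_apply (R := k) w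
    rw [hw.comul_eq, hw.counit_eq_zero] at h
    simp only [map_add, LinearMap.rTensor_tmul, LinearMap.mul'_apply, mul_one, map_zero] at h
    rw [eq_neg_of_add_eq_zero_right h]
    exact neg_mem (I.mul_mem_left _ hwI)
  have hS : ∀ z ∈ I, HopfAlgebra.antipode k z ∈ I := by
    apply hind
    · exact hSw
    · simp
    · intro x y hx hy; rw [map_add]; exact add_mem hx hy
    · intro x hx; rw [map_neg]; exact neg_mem hx
    · intro a x hx; rw [HopfAlgebra.antipode_mul_antidistrib]; exact I.mul_mem_right _ hx
    · intro a x hx; rw [HopfAlgebra.antipode_mul_antidistrib]; exact I.mul_mem_left _ hx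
  have hann : ∀ z ∈ I, ρ.toEnd z = 0 := by
    apply hind
    · exact h0
    · simp
    · intro x y hx hy; rw [map_add, hx, hy, add_zero]
    · intro x hx; rw [map_neg, hx, neg_zero]
    · intro a x hx; rw [_root_.map_mul, hx, mul_zero]
    · intro a x hx; rw [_root_.map_mul, hx, zero_mul]
  have hhopf : I.IsHopfIdeal k :=
    { counit_eq_zero := fun z hz => hε z hz
      map_mkQ_comul_eq_zero := fun z hz => hΨ z hz
      antipode_mem := fun z hz => hS z hz }
  have hbot := hρ I inferInstance hhopf (fun z hz a => by rw [hann z hz, LinearMap.zero_apply])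
  rw [hbot] at hwI
  exact hwI

/-- The grouplikes act faithfully in an inner faithful action. -/
lemma IsInnerFaithful.groupLikeAut_injective (hρ : ρ.IsInnerFaithful) :
    Function.Injective ρ.groupLikeAut := by
  rw [injective_iff_map_eq_one]
  intro a ha
  have h : a.val - 1 = 0 := by
    refine hρ.eq_zero_of_toEnd_eq_zero (IsSkewPrimitive.sub_one a) ?_
    ext l
    have := congrArg (fun σ : A ≃ₐ[k] A => σ l) ha
    rw [map_sub, _root_.map_one, LinearMap.sub_apply, ← groupLikeAut_apply]
    simpa [sub_eq_zero] using this
  exact GroupLike.val_injective (sub_eq_zero.1 h)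

end

section Field

variable {k : Type u} [Field k] {H : Type v} [Ring H] [HopfAlgebra k H]
  {L : Type w} [Field L] [Algebra k L] {ρ : HopfAction k H L}

/-- On a field a skew-primitive element acts by `v (1 - g)` for some `v`, because the product is
commutative. -/
lemma exists_toEnd_eq_twistedDifference {g : GroupLike k H} {x : H}
    (hx : IsSkewPrimitive k g.val 1 x) (hg : ρ.groupLikeAut g ≠ 1) :
    ∃ v : L, ρ.toEnd x = twistedDifference (ρ.groupLikeAut g) v := by
  obtain ⟨b, hb⟩ : ∃ b, ρ.groupLikeAut g b ≠ b := by
    by_contra! h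
    exact hg (AlgEquiv.ext h)
  refine ⟨ρ.toEnd x b / (b - ρ.groupLikeAut g b), ?_⟩
  ext l
  have h1 := ρ.skewPrimitive_mul hx l b
  have h2 := ρ.skewPrimitive_mul hx b l
  rw [mul_comm, h2, ← groupLikeAut_apply, ← groupLikeAut_apply] at h1
  rw [twistedDifference_apply, div_mul_eq_mul_div, eq_div_iff (sub_ne_zero.2 (Ne.symm hb))]
  linear_combination -h1

variable {g : GroupLike k H} {y : H} {n : ℕ} {ζ : k}

lemma IsInnerFaithful.groupLikeAut_ne_one (hρ : ρ.IsInnerFaithful) (h : IsEigenPair g y n ζ) :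
    ρ.groupLikeAut g ≠ 1 := by
  intro h1
  have hg : g = 1 := hρ.groupLikeAut_injective (by rw [h1, _root_.map_one])
  have h2 := h.dvd_of_pow_eq_one (m := 1) (by rw [hg, one_pow])
  have := Nat.le_of_dvd one_pos h2
  have := h.two_le
  omega

/-- In an inner faithful action on a field, the function `v` through which `y` acts is a nonzero
eigenvector of `g`. -/
lemma IsInnerFaithful.exists_eigenvector (hρ : ρ.IsInnerFaithful) (h : IsEigenPair g y n ζ) :
    ∃ v : L, v ≠ 0 ∧ ρ.groupLikeAut g v = ζ • v ∧
      ρ.toEnd y = twistedDifference (ρ.groupLikeAut g) v := by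
  have hg := hρ.groupLikeAut_ne_one h
  obtain ⟨v, hv⟩ := exists_toEnd_eq_twistedDifference h.isSkewPrimitive hg
  refine ⟨v, ?_, ?_, hv⟩
  · rintro rfl
    apply h.notMem
    rw [hρ.eq_zero_of_toEnd_eq_zero h.isSkewPrimitive (by
      rw [hv]; ext l; rw [twistedDifference_apply]; simp)]
    exact Submodule.zero_mem _
  · obtain ⟨b, hb⟩ : ∃ b, ρ.groupLikeAut g b ≠ b := by
      by_contra! h
      exact hg (AlgEquiv.ext h)
    have h1 := congrArg (fun z => ρ.toEnd z b) h.mul_eq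
    simp only [_root_.map_mul, map_smul, Module.End.mul_apply, LinearMap.smul_apply, hv,
      twistedDifference_apply] at h1
    rw [← groupLikeAut_apply, ← groupLikeAut_apply, _root_.map_mul, ← smul_mul_assoc,
      ← map_sub] at h1
    exact mul_right_cancel₀ (by simpa [sub_eq_zero] using Ne.symm hb) h1

/-- An inner faithful action on a field forces the Taft relations: otherwise `vⁿ`, hence `v`, would
be a scalar, fixed by `g`. -/
theorem IsInnerFaithful.pow_eq [IsAlgClosed k] [FiniteDimensional k H] (hp : IsPointed k H)
    (hr : HasRank k H 1) (hρ : ρ.IsInnerFaithful) (h : IsEigenPair g y n ζ) :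
    g ^ n = 1 ∧ y ^ n = 0 := by
  obtain ⟨v, hv0, hgv, hv⟩ := hρ.exists_eigenvector h
  obtain ⟨c, hc⟩ := h.exists_pow_eq_smul hp hr
  have hn : 0 < n := by have := h.two_le; omega
  suffices hgn : g ^ n = 1 by
    refine ⟨hgn, ?_⟩
    rw [hc, hgn, GroupLike.val_one, sub_self, smul_zero]
  by_contra hgn
  obtain ⟨b, hb⟩ : ∃ b, (ρ.groupLikeAut g ^ n) b ≠ b := by
    by_contra! hall
    exact hgn (hρ.groupLikeAut_injective (by rw [map_pow, _root_.map_one]; exact AlgEquiv.ext hall))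
  have h1 : ρ.toEnd (y ^ n) b = v ^ n * (b - (ρ.groupLikeAut g ^ n) b) := by
    rw [map_pow, hv, twistedDifference_pow_eq hn h.isPrimitiveRoot hgv]
  rw [hc, map_smul, map_sub, _root_.map_one, LinearMap.smul_apply, LinearMap.sub_apply,
    ← groupLikeAut_apply, map_pow, Module.End.one_apply] at h1
  have hvn : v ^ n = algebraMap k L (-c) := by
    have hne : b - (ρ.groupLikeAut g ^ n) b ≠ 0 := sub_ne_zero.2 (Ne.symm hb)
    apply mul_right_cancel₀ hne
    rw [← h1, map_neg, Algebra.smul_def]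
    ring
  obtain ⟨z, hz⟩ := IsAlgClosed.exists_pow_nat_eq (-c) hn
  have hz0 : algebraMap k L z ≠ 0 := by
    intro h0
    rw [← hz, map_pow, h0, zero_pow hn.ne'] at hvn
    exact hv0 (pow_eq_zero_iff hn.ne' |>.1 hvn)
  have hroot : (v / algebraMap k L z) ^ n = 1 := by
    rw [div_pow, hvn, ← hz, map_pow, div_self (pow_ne_zero _ hz0)]
  have : NeZero n := ⟨hn.ne'⟩
  obtain ⟨i, -, hi⟩ := (h.isPrimitiveRoot.map_of_injective
    (algebraMap k L).injective).eq_pow_of_pow_eq_one hroot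
  have hvk : v = algebraMap k L (ζ ^ i * z) := by
    rw [_root_.map_mul, map_pow, hi, div_mul_cancel₀ _ hz0]
  have hfix : ρ.groupLikeAut g v = v := by rw [hvk, AlgEquiv.commutes]
  rw [hfix] at hgv
  have : (ζ - 1) • v = 0 := by rw [sub_smul, ← hgv, one_smul, sub_self]
  exact hv0 ((smul_eq_zero.1 this).resolve_left (sub_ne_zero.2 h.ne_one))

lemma mem_fixedPoints_iff {K : Subgroup (GroupLike k H)} {l : L} :
    l ∈ ρ.fixedPoints K ↔ ∀ t ∈ K, ρ.groupLikeAut t l = l := Iff.rfl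

lemma coe_fixedField_map (K : Subgroup (GroupLike k H)) :
    (IntermediateField.fixedField (K.map ρ.groupLikeAut) : Set L) = ρ.fixedPoints K := by
  ext l
  rw [SetLike.mem_coe, IntermediateField.mem_fixedField_iff, mem_fixedPoints_iff]
  constructor
  · intro h t ht
    exact h _ ⟨t, ht, rfl⟩
  · rintro h _ ⟨t, ht, rfl⟩
    exact h t ht

end Field

end HopfAction

/-! ### Fixed fields -/

section FixedField

variable {k : Type u} [Field k] {L : Type w} [Field L] [Algebra k L]

lemma isGalois_fixedField (K : Subgroup (L ≃ₐ[k] L)) [Finite K] :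
    IsGalois (IntermediateField.fixedField K) L :=
  IsGalois.of_fixed_field L K

lemma finrank_fixedField (K : Subgroup (L ≃ₐ[k] L)) [Finite K] :
    Module.finrank (IntermediateField.fixedField K) L = Nat.card K := by
  have := Fintype.ofFinite K
  rw [Nat.card_eq_fintype_card]
  exact FixedPoints.finrank_eq_card K L

lemma isCyclic_aut_fixedField (K : Subgroup (L ≃ₐ[k] L)) [Finite K] [IsCyclic K] :
    IsCyclic (L ≃ₐ[IntermediateField.fixedField K] L) :=
  isCyclic_of_surjective (FixedPoints.toAlgAutMulEquiv K L) (MulEquiv.surjective _)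

end FixedField

/-! ### Independence of characters -/

section Dedekind

variable {k : Type u} [Field k] {L : Type w} [Field L] [Algebra k L] {G : Type v} [Group G]

/-- Dedekind's independence of characters for a faithful action. -/
lemma coeff_eq_zero_of_sum_smul_eq_zero [Fintype G] {σ : G →* (L ≃ₐ[k] L)}
    (hσ : Function.Injective σ) {c : G → k} (h : ∀ l, ∑ a, c a • σ a l = 0) (a : G) : c a = 0 := by
  have hinj : Function.Injective fun a : G => ((σ a : L ≃ₐ[k] L) : L →* L) := by
    intro a b hab
    exact hσ (AlgEquiv.ext fun l => DFunLike.congr_fun hab l)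
  have hli := (linearIndependent_monoidHom L L).comp _ hinj
  have := Fintype.linearIndependent_iff.1 hli (fun a => algebraMap k L (c a)) (by
    ext l
    simpa [Algebra.smul_def] using h l) a
  simpa using this

/-- Every character of a finite group of automorphisms of `L` with values in `k` is afforded by a
nonzero element of `L`. -/
lemma exists_eigenvector_of_character [Finite G] {σ : G →* (L ≃ₐ[k] L)}
    (hσ : Function.Injective σ) (χ : G →* k) :
    ∃ v : L, v ≠ 0 ∧ ∀ a, σ a v = χ a • v := by
  have := Fintype.ofFinite G
  obtain ⟨l, hl⟩ : ∃ l, ∑ a, χ a⁻¹ • σ a l ≠ 0 := by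
    by_contra! h
    have := coeff_eq_zero_of_sum_smul_eq_zero hσ h 1
    simp at this
  refine ⟨_, hl, fun b => ?_⟩
  rw [map_sum, Finset.smul_sum]
  refine Fintype.sum_equiv (Equiv.mulLeft b) _ _ fun a => ?_
  rw [map_smul, Equiv.coe_mulLeft, smul_smul, mul_comm (χ b), ← map_mul, map_mul σ,
    AlgEquiv.mul_apply, mul_inv_rev, inv_mul_cancel_right]

end Dedekind

/-! ### Extending actions of the grouplikes -/

section Extension

variable {k : Type u} [Field k] {H : Type v} [Ring H] [HopfAlgebra k H]
  {L : Type w} [Field L] [Algebra k L]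

/-- The module algebra axiom for products needs to be checked on algebra generators only. -/
lemma toEnd_mul_of_adjoin_eq_top {A : Type w} [CommRing A] [Algebra k A]
    (ρ : H →ₐ[k] Module.End k A) {s : Set H} (hs : Algebra.adjoin k s = ⊤)
    (h : ∀ x ∈ s, ∀ a b : A, ρ x (a * b) = LinearMap.mul' k A
      (TensorProduct.map (ρ.toLinearMap.flip a) (ρ.toLinearMap.flip b)
        (Coalgebra.comul (R := k) x))) (x : H) :
    ∀ a b : A, ρ x (a * b) = LinearMap.mul' k A
      (TensorProduct.map (ρ.toLinearMap.flip a) (ρ.toLinearMap.flip b)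
        (Coalgebra.comul (R := k) x)) := by
  have hx : x ∈ Algebra.adjoin k s := by rw [hs]; trivial
  induction hx using Algebra.adjoin_induction with
  | mem x hx => exact h x hx
  | algebraMap r =>
    intro a b
    simp [Bialgebra.comul_algebraMap, Algebra.TensorProduct.algebraMap_apply]
  | add x y _ _ hx hy =>
    intro a b
    rw [map_add, LinearMap.add_apply, hx, hy, map_add, map_add, map_add]
  | mul x y _ _ hx hy =>
    intro a b
    have h1 : ∀ (T : H ⊗[k] H) (p q : H), LinearMap.mul' k A
        (TensorProduct.map (ρ.toLinearMap.flip (ρ p a)) (ρ.toLinearMap.flip (ρ q b)) T) =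
        LinearMap.mul' k A (TensorProduct.map (ρ.toLinearMap.flip a) (ρ.toLinearMap.flip b)
          (T * (p ⊗ₜ[k] q))) := by
      intro T p q
      induction T with
      | zero => simp
      | add S T hS hT => simp only [map_add, hS, hT, add_mul]
      | tmul p' q' => simp
    have h2 : ∀ T : H ⊗[k] H, ρ x (LinearMap.mul' k A
        (TensorProduct.map (ρ.toLinearMap.flip a) (ρ.toLinearMap.flip b) T)) =
        LinearMap.mul' k A (TensorProduct.map (ρ.toLinearMap.flip a) (ρ.toLinearMap.flip b)
          (Coalgebra.comul (R := k) x * T)) := by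
      intro T
      induction T with
      | zero => simp
      | add S T hS hT => simp only [map_add, hS, hT, mul_add]
      | tmul p q => rw [← h1, ← hx]; simp
    rw [map_mul ρ, Module.End.mul_apply, hy, h2, Bialgebra.comul_mul]

lemma toEnd_one_of_adjoin_eq_top {A : Type w} [CommRing A] [Algebra k A]
    (ρ : H →ₐ[k] Module.End k A) {s : Set H} (hs : Algebra.adjoin k s = ⊤)
    (h : ∀ x ∈ s, ρ x 1 = algebraMap k A (Coalgebra.counit (R := k) x)) (x : H) :
    ρ x 1 = algebraMap k A (Coalgebra.counit (R := k) x) := by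
  have hx : x ∈ Algebra.adjoin k s := by rw [hs]; trivial
  induction hx using Algebra.adjoin_induction with
  | mem x hx => exact h x hx
  | algebraMap r => simp [Algebra.algebraMap_eq_smul_one]
  | add x y _ _ hx hy => rw [map_add, LinearMap.add_apply, hx, hy, map_add, map_add]
  | mul x y _ _ hx hy =>
    rw [map_mul, Module.End.mul_apply, hy, Algebra.algebraMap_eq_smul_one, map_smul, hx,
      Bialgebra.counit_mul, map_mul, Algebra.smul_def, mul_comm]

namespace IsEigenPair

variable {g : GroupLike k H} {y : H} {n : ℕ} {ζ : k}

lemma span_pow_mul_eq_top (h : IsEigenPair g y n ζ) {χ : GroupLike k H →* k}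
    (hχ : ∀ a : GroupLike k H, a.val * y = χ a • (y * a.val)) (hyn : y ^ n = 0)
    (hgen : Algebra.adjoin k (insert y {a : H | IsGroupLikeElem k a}) = ⊤) :
    Submodule.span k (Set.range fun p : Fin n × GroupLike k H => y ^ (p.1 : ℕ) * p.2.val) = ⊤ := by
  set S := Submodule.span k (Set.range fun p : Fin n × GroupLike k H => y ^ (p.1 : ℕ) * p.2.val)
    with hS
  have hmem : ∀ i ≤ n, ∀ a : GroupLike k H, y ^ i * a.val ∈ S := by
    intro i hi a
    rcases hi.eq_or_lt with rfl | hi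
    · rw [hyn, zero_mul]; exact S.zero_mem
    · exact Submodule.subset_span ⟨(⟨i, hi⟩, a), rfl⟩
  have hyS : ∀ s ∈ S, y * s ∈ S := by
    intro s hs
    induction hs using Submodule.span_induction with
    | mem z hz =>
      obtain ⟨⟨i, a⟩, rfl⟩ := hz
      dsimp only
      rw [← mul_assoc, ← pow_succ']
      exact hmem _ i.2 a
    | zero => simp
    | add y z _ _ hy hz => rw [mul_add]; exact S.add_mem hy hz
    | smul c y _ hy => rw [mul_smul_comm]; exact S.smul_mem _ hy
  have haS : ∀ (b : GroupLike k H), ∀ s ∈ S, b.val * s ∈ S := by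
    intro b s hs
    induction hs using Submodule.span_induction with
    | mem z hz =>
      obtain ⟨⟨i, a⟩, rfl⟩ := hz
      dsimp only
      rw [← mul_assoc, mul_pow_of_skewCommute (hχ b), smul_mul_assoc, mul_assoc,
        ← GroupLike.val_mul]
      exact S.smul_mem _ (hmem _ i.2.le _)
    | zero => simp
    | add y z _ _ hy hz => rw [mul_add]; exact S.add_mem hy hz
    | smul c y _ hy => rw [mul_smul_comm]; exact S.smul_mem _ hy
  have hall : ∀ t ∈ Algebra.adjoin k (insert y {a : H | IsGroupLikeElem k a}),
      ∀ s ∈ S, t * s ∈ S := by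
    intro t ht
    induction ht using Algebra.adjoin_induction with
    | mem z hz =>
      rcases hz with rfl | hz
      · exact hyS
      · exact haS ⟨z, hz⟩
    | algebraMap r => intro s hs; rw [← Algebra.smul_def]; exact S.smul_mem _ hs
    | add a b _ _ ha hb => intro s hs; rw [add_mul]; exact S.add_mem (ha s hs) (hb s hs)
    | mul a b _ _ ha hb => intro s hs; rw [mul_assoc]; exact ha _ (hb s hs)
  rw [eq_top_iff]
  intro t _
  have := hall t (by rw [hgen]; trivial) 1 (by simpa using hmem 0 (Nat.zero_le _) 1)
  rwa [mul_one] at this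

lemma character_self (h : IsEigenPair g y n ζ) {χ : GroupLike k H →* k}
    (hχ : ∀ a : GroupLike k H, a.val * y = χ a • (y * a.val)) : χ g = ζ := by
  have h1 := hχ g
  rw [h.mul_eq, ← sub_eq_zero, ← sub_smul] at h1
  have hne : y * g.val ≠ 0 := by
    intro h0
    apply h.notMem
    rw [← mul_groupLike_mem_groupSpan_iff g, h0]
    exact Submodule.zero_mem _
  exact (sub_eq_zero.1 ((smul_eq_zero.1 h1).resolve_right hne)).symm

/-- Given the Taft relations, the algebra `H` has the presentation that lets an action of the
grouplikes on `L` extend to `H`, with `y` acting by `v (1 - g)`. -/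
theorem exists_algHom [Finite (GroupLike k H)] (h : IsEigenPair g y n ζ)
    (hg : g ∈ Subgroup.center (GroupLike k H)) {χ : GroupLike k H →* k}
    (hχ : ∀ a : GroupLike k H, a.val * y = χ a • (y * a.val)) (hgn : g ^ n = 1) (hyn : y ^ n = 0)
    (hgen : Algebra.adjoin k (insert y {a : H | IsGroupLikeElem k a}) = ⊤)
    (σ : GroupLike k H →* (L ≃ₐ[k] L)) {v : L} (hv : ∀ a, σ a v = χ a • v) :
    ∃ ρ : H →ₐ[k] Module.End k L, (∀ a : GroupLike k H, ρ a.val = (σ a).toLinearMap) ∧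
      ρ y = twistedDifference (σ g) v := by
  have h0n : 0 < n := by have := h.two_le; omega
  let b := Module.Basis.mk h.linearIndependent_pow_mul
    (h.span_pow_mul_eq_top hχ hyn hgen).ge
  have hb : ∀ p, b p = y ^ (p.1 : ℕ) * p.2.val := fun p => Module.Basis.mk_apply _ _ p
  set X := twistedDifference (σ g) v with hX
  let ρ : H →ₗ[k] Module.End k L := b.constr k fun p => X ^ (p.1 : ℕ) * (σ p.2).toLinearMap
  have hXn : X ^ n = 0 := by
    ext l
    rw [hX, twistedDifference_pow_eq h0n h.isPrimitiveRoot (by rw [hv, h.character_self hχ]),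
      ← map_pow, hgn, map_one, AlgEquiv.one_apply, sub_self, mul_zero, LinearMap.zero_apply]
  have hρ : ∀ (m : ℕ) (a : GroupLike k H), ρ (y ^ m * a.val) = X ^ m * (σ a).toLinearMap := by
    intro m a
    rcases lt_or_ge m n with hm | hm
    · have := b.constr_basis k (fun p => X ^ (p.1 : ℕ) * (σ p.2).toLinearMap) (⟨m, hm⟩, a)
      rwa [hb] at this
    · obtain ⟨j, rfl⟩ := Nat.exists_eq_add_of_le hm
      rw [pow_add, pow_add, hyn, hXn, zero_mul, zero_mul, zero_mul, zero_mul, map_zero]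
  have hcomm : ∀ a : GroupLike k H,
      (σ a).toLinearMap * X = χ a • (X * (σ a).toLinearMap) := by
    intro a
    ext l
    have hag : σ a (σ g l) = σ g (σ a l) := by
      rw [← AlgEquiv.mul_apply, ← AlgEquiv.mul_apply, ← map_mul, ← map_mul,
        Subgroup.mem_center_iff.1 hg a]
    simp only [Module.End.mul_apply, LinearMap.smul_apply, AlgEquiv.toLinearMap_apply, hX,
      twistedDifference_apply, map_mul, map_sub, hv, hag, smul_mul_assoc]
  have hmul : ∀ (a b : GroupLike k H),
      (σ a).toLinearMap * (σ b).toLinearMap = (σ (a * b)).toLinearMap := by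
    intro a b
    ext l
    simp
  have hρmul : (LinearMap.mul k H).compr₂ ρ = (LinearMap.mul k (Module.End k L)).compl₁₂ ρ ρ := by
    refine b.ext fun p => b.ext fun q => ?_
    have e1 : y ^ (p.1 : ℕ) * p.2.val * (y ^ (q.1 : ℕ) * q.2.val) =
        χ p.2 ^ (q.1 : ℕ) • (y ^ ((p.1 : ℕ) + q.1) * (p.2 * q.2).val) := by
      rw [mul_assoc, ← mul_assoc p.2.val, mul_pow_of_skewCommute (hχ p.2), smul_mul_assoc,
        mul_smul_comm, GroupLike.val_mul, pow_add]
      simp only [mul_assoc]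
    have e2 : X ^ (p.1 : ℕ) * (σ p.2).toLinearMap * (X ^ (q.1 : ℕ) * (σ q.2).toLinearMap) =
        χ p.2 ^ (q.1 : ℕ) • (X ^ ((p.1 : ℕ) + q.1) * (σ (p.2 * q.2)).toLinearMap) := by
      rw [mul_assoc, ← mul_assoc (σ p.2).toLinearMap, mul_pow_of_skewCommute (k := k) (hcomm p.2),
        smul_mul_assoc, mul_smul_comm, ← hmul, pow_add]
      simp only [mul_assoc]
    rw [LinearMap.compr₂_apply, LinearMap.compl₁₂_apply, LinearMap.mul_apply', LinearMap.mul_apply',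
      hb, hb, e1, map_smul, hρ, hρ, hρ, e2]
  have hρ1 : ρ 1 = 1 := by
    have := hρ 0 1
    rw [pow_zero, pow_zero, GroupLike.val_one, one_mul, one_mul, map_one σ] at this
    rw [this]
    rfl
  refine ⟨AlgHom.ofLinearMap ρ hρ1 fun p q => LinearMap.congr_fun₂ hρmul p q, fun a => ?_, ?_⟩
  · have := hρ 0 a
    rwa [pow_zero, pow_zero, one_mul, one_mul] at this
  · have := hρ 1 1
    rw [pow_one, pow_one, GroupLike.val_one, mul_one, map_one σ] at this
    exact this.trans (mul_one X)

/-- Given the Taft relations, a faithful action of the grouplikes on a field extends to an inner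
faithful action of `H`. -/
theorem exists_hopfAction [Finite (GroupLike k H)] (h : IsEigenPair g y n ζ)
    (hg : g ∈ Subgroup.center (GroupLike k H)) {χ : GroupLike k H →* k}
    (hχ : ∀ a : GroupLike k H, a.val * y = χ a • (y * a.val)) (hgn : g ^ n = 1) (hyn : y ^ n = 0)
    (hgen : Algebra.adjoin k (insert y {a : H | IsGroupLikeElem k a}) = ⊤)
    (σ : GroupLike k H →* (L ≃ₐ[k] L)) (hσ : Function.Injective σ) :
    ∃ ρ : HopfAction k H L, ρ.IsInnerFaithful ∧
      ∀ (a : GroupLike k H) (l : L), ρ.toEnd a.val l = σ a l := by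
  classical
  have := Fintype.ofFinite (GroupLike k H)
  obtain ⟨v, hv0, hv⟩ := exists_eigenvector_of_character hσ χ
  obtain ⟨ρ, hρa, hρy⟩ := h.exists_algHom hg hχ hgn hyn hgen σ hv
  have hmul := toEnd_mul_of_adjoin_eq_top ρ hgen (by
    rintro z (rfl | hz) l m
    · rw [h.isSkewPrimitive.comul_eq, hρy]
      simp only [map_add, TensorProduct.map_tmul, LinearMap.mul'_apply, LinearMap.flip_apply,
        AlgHom.toLinearMap_apply, hρy, hρa, map_one, Module.End.one_apply, twistedDifference_apply,
        AlgEquiv.toLinearMap_apply, map_mul]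
      ring
    · obtain ⟨a, rfl⟩ : ∃ a : GroupLike k H, a.val = z := ⟨⟨z, hz⟩, rfl⟩
      rw [hz.comul_eq_tmul_self, hρa]
      simp [hρa])
  have hone := toEnd_one_of_adjoin_eq_top ρ hgen (by
    rintro z (rfl | hz)
    · rw [h.isSkewPrimitive.counit_eq_zero, hρy, twistedDifference_apply]
      simp
    · obtain ⟨a, rfl⟩ : ∃ a : GroupLike k H, a.val = z := ⟨⟨z, hz⟩, rfl⟩
      rw [hz.counit_eq_one, hρa]
      simp)
  refine ⟨⟨ρ, hmul, hone⟩, ?_, fun a l => by rw [hρa]; rfl⟩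
  intro I _ hI hann
  have hI' : (I.restrictScalars k).IsCoideal := hI.toIsCoideal
  have hW0 : ∀ z ∈ groupSpan k H, z ∈ I.restrictScalars k → z = 0 := by
    intro z hz hzI
    obtain ⟨c, rfl⟩ := mem_groupSpan_iff.1 hz
    have hc := coeff_eq_zero_of_sum_smul_eq_zero hσ (c := c) fun l => by
      have := hann _ hzI l
      simpa [hρa] using this
    simp [hc]
  have hW1 : ∀ (d α : k) (b : GroupLike k H),
      d • (y * b.val) + α • ((g * b).val - b.val) ∈ I.restrictScalars k → d = 0 := by
    intro d α b hmem
    obtain ⟨l, hl⟩ : ∃ l, σ g l ≠ l := by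
      by_contra! hall
      have hg1 : g = 1 := hσ (by rw [map_one]; exact AlgEquiv.ext hall)
      have h1 := Nat.le_of_dvd one_pos (h.dvd_of_pow_eq_one (m := 1) (by rw [hg1, one_pow]))
      have h2 := h.two_le
      omega
    have hact : ρ (d • (y * b.val) + α • ((g * b).val - b.val)) (σ b⁻¹ l) = 0 := hann _ hmem _
    have hbl : σ b (σ b⁻¹ l) = l := by
      rw [← AlgEquiv.mul_apply, ← map_mul, mul_inv_cancel, map_one, AlgEquiv.one_apply]
    simp only [map_add, map_smul, map_sub, map_mul, GroupLike.val_mul, hρa, hρy,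
      LinearMap.add_apply, LinearMap.smul_apply, LinearMap.sub_apply, Module.End.mul_apply,
      AlgEquiv.toLinearMap_apply, hbl, twistedDifference_apply] at hact
    -- The operator is `(d v - α)(1 - g)` up to an automorphism, so `d v` is a scalar.
    have hdv : d • v = algebraMap k L α := by
      apply mul_right_cancel₀ (sub_ne_zero.2 (Ne.symm hl))
      rw [smul_mul_assoc, ← Algebra.smul_def, ← sub_eq_zero, ← hact, ← neg_sub (σ g l), smul_neg]
      simp
    have h1 := congrArg (σ g) hdv
    rw [map_smul, hv, h.character_self hχ, AlgEquiv.commutes, ← hdv, ← sub_eq_zero, ← smul_sub,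
      smul_eq_zero] at h1
    refine h1.resolve_right fun h2 => ?_
    have h3 : (ζ - 1) • v = 0 := by rw [sub_smul, one_smul, h2]
    exact hv0 ((smul_eq_zero.1 h3).resolve_left (sub_ne_zero.2 h.ne_one))
  rw [eq_bot_iff]
  intro z hz
  have hspan : z ∈ Submodule.span k (Set.range fun p : Fin n × GroupLike k H =>
      y ^ (p.1 : ℕ) * p.2.val) := by
    rw [h.span_pow_mul_eq_top hχ hyn hgen]; trivial
  obtain ⟨c, rfl⟩ := (Submodule.mem_span_range_iff_exists_fun k).1 hspan
  have hc := h.isSkewPrimitive.coeff_eq_zero h.mul_eq hI' hW0 hW1 n h.sum_pow_ne_zero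
    (fun i a => if hi : i < n then c (⟨i, hi⟩, a) else 0) (by
      rw [Finset.sum_range]
      rw [Fintype.sum_prod_type] at hz
      simpa using hz)
  have hc' : ∀ p, c p = 0 := by
    rintro ⟨i, a⟩
    simpa using hc i i.2 a
  simp [hc']

end IsEigenPair

end Extension

/-! ### A field with a faithful action -/

section FaithfulField

/-- Every finite group acts faithfully on a purely transcendental extension of `k`, by permuting the
variables. -/
lemma exists_field_faithful_action (k : Type u) [Field k] (G : Type v) [Group G] [Finite G] :
    ∃ (L : Type (max u w)) (_ : Field L) (_ : Algebra k L) (σ : G →* (L ≃ₐ[k] L)),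
      Function.Injective σ := by
  obtain ⟨m, ⟨e⟩⟩ := Finite.exists_equiv_fin G
  let ι := ULift.{w} (Fin m)
  let e' : G ≃ ι := e.trans Equiv.ulift.symm
  let perm : Equiv.Perm ι →* (MvPolynomial ι k ≃ₐ[k] MvPolynomial ι k) :=
    { toFun := fun τ => MvPolynomial.renameEquiv k τ
      map_one' := MvPolynomial.renameEquiv_refl k
      map_mul' := fun τ τ' => (MvPolynomial.renameEquiv_trans k τ' τ).symm }
  have hperm : Function.Injective perm := by
    intro τ τ' h
    ext1 i
    have := congrArg (fun f : MvPolynomial ι k ≃ₐ[k] MvPolynomial ι k => f (MvPolynomial.X i)) h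
    simpa [perm] using this
  let L := FractionRing (MvPolynomial ι k)
  let frac := IsFractionRing.fieldEquivOfAlgEquivHom (A := k) (B := MvPolynomial ι k) k L
  refine ⟨L, inferInstance, inferInstance, frac.comp (perm.comp
    ((e'.permCongrHom.toMonoidHom).comp (MulAction.toPermHom G G))), ?_⟩
  exact (IsFractionRing.fieldEquivOfAlgEquivHom_injective k (MvPolynomial ι k) k L).comp
    (hperm.comp (e'.permCongrHom.injective.comp MulAction.toPerm_injective))

end FaithfulField

/-! ### Invariants and the Taft criterion -/

section Main

variable {k : Type u} [Field k] {H : Type v} [Ring H] [HopfAlgebra k H] [FiniteDimensional k H]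
  {g : GroupLike k H} {x : H} {n : ℕ} {ζ : k}

theorem IsTaft.exists_hopfAction (hp : IsPointed k H) (hr : HasRank k H 1)
    (hgx : IsGeneratingPair k g x) (hT : IsTaft (Algebra.adjoin k {g.val, x}) n ζ)
    {L : Type w} [Field L] [Algebra k L] (σ : GroupLike k H →* (L ≃ₐ[k] L))
    (hσ : Function.Injective σ) :
    ∃ ρ : HopfAction k H L, ρ.IsInnerFaithful ∧ ρ.toEnd x ≠ 0 ∧
      ∀ (a : GroupLike k H) (l : L), ρ.toEnd a.val l = σ a l := by
  have := finite_groupLike (k := k) (C := H)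
  have hxn := hgx.notMem_groupSpan hp hr
  obtain ⟨β, c, -, hy, hgn, hyn⟩ := hT.exists_isEigenPair hp hr hgx.isSkewPrimitive hxn
  obtain ⟨χ, hχ⟩ := hy.exists_character hp hr hgx.mem_center
  obtain ⟨ρ, hρ, hρσ⟩ := hy.exists_hopfAction hgx.mem_center hχ hgn hyn
    (hr.isGeneratingPair hp hy.isSkewPrimitive hy.notMem).adjoin_eq_top σ hσ
  refine ⟨ρ, hρ, fun h0 => hxn ?_, hρσ⟩
  rw [hρ.eq_zero_of_toEnd_eq_zero hgx.isSkewPrimitive h0]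
  exact Submodule.zero_mem _

/-- An inner faithful action on a field forces the subalgebra generated by `g` and `x` to be a Taft
algebra, with generators `g` and the normalization `x + c (g - 1)`. -/
theorem IsGeneratingPair.exists_isTaft [IsAlgClosed k] [CharZero k] (hp : IsPointed k H)
    (hr : HasRank k H 1) (hgx : IsGeneratingPair k g x) {L : Type w} [Field L] [Algebra k L]
    {ρ : HopfAction k H L} (hρ : ρ.IsInnerFaithful) :
    ∃ (n : ℕ) (ζ : k), IsTaft (Algebra.adjoin k {g.val, x}) n ζ := by
  obtain ⟨n, ζ, c, hy⟩ := hr.exists_isEigenPair hp hgx.isSkewPrimitive (hgx.notMem_groupSpan hp hr)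
  obtain ⟨hgn, hyn⟩ := hρ.pow_eq hp hr hy
  refine ⟨n, ζ, ?_⟩
  rw [← adjoin_pair_eq (k := k) (x := x) one_ne_zero (by rw [one_smul])]
  exact hy.isTaft hgn hyn

/-- An element fixed by `g` is annihilated by `x`, so the invariants of `H` and of the subalgebra
generated by `g` and `x` are fields of fixed points, to which Artin's theorem applies. -/
theorem IsTaft.exists_invariants (hp : IsPointed k H)
    (hr : HasRank k H 1) (hgx : IsGeneratingPair k g x)
    (hT : IsTaft (Algebra.adjoin k {g.val, x}) n ζ) {L : Type w} [Field L] [Algebra k L]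
    (ρ : HopfAction k H L) (hρ : ρ.IsInnerFaithful) :
    ∃ F E : IntermediateField k L, F ≤ E ∧
      ((F : Set L) = ρ.invariants ⊤ ∧ (F : Set L) = ρ.fixedPoints ⊤ ∧ IsGalois F L) ∧
      ((E : Set L) = ρ.invariants (Algebra.adjoin k {g.val, x}) ∧
        (E : Set L) = ρ.fixedPoints (Subgroup.zpowers g) ∧
        IsGalois E L ∧ IsCyclic (L ≃ₐ[E] L) ∧ Module.finrank E L = n) := by
  have := finite_groupLike (k := k) (C := H)
  obtain ⟨β, c, -, hy, hgn, -⟩ :=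
    hT.exists_isEigenPair hp hr hgx.isSkewPrimitive (hgx.notMem_groupSpan hp hr)
  obtain ⟨v, hv⟩ := HopfAction.exists_toEnd_eq_twistedDifference (ρ := ρ) hgx.isSkewPrimitive
    (hρ.groupLikeAut_ne_one hy)
  have hxl : ∀ l, ρ.toEnd g.val l = l →
      ρ.toEnd x l = Coalgebra.counit (R := k) x • l := by
    intro l hl
    rw [hv, twistedDifference_apply, HopfAction.groupLikeAut_apply, hl,
      hgx.isSkewPrimitive.counit_eq_zero]
    simp
  have hfin : ∀ K : Subgroup (GroupLike k H), Finite (K.map ρ.groupLikeAut) := fun K =>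
    ((Set.toFinite (K : Set (GroupLike k H))).image ρ.groupLikeAut).to_subtype
  have hfinK := hfin (Subgroup.zpowers g)
  have hfinG := hfin ⊤
  let K := (Subgroup.zpowers g).map ρ.groupLikeAut
  have hK : K = Subgroup.zpowers (ρ.groupLikeAut g) := MonoidHom.map_zpowers _ _
  have hcyc : IsCyclic K := by rw [hK]; infer_instance
  have hcard : Nat.card K = n := by
    rw [hK, Nat.card_zpowers, orderOf_injective _ hρ.groupLikeAut_injective, hy.orderOf_eq hgn]
  refine ⟨IntermediateField.fixedField ((⊤ : Subgroup (GroupLike k H)).map ρ.groupLikeAut),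
    IntermediateField.fixedField K, ?_, ⟨?_, HopfAction.coe_fixedField_map _,
      isGalois_fixedField _⟩, ?_, HopfAction.coe_fixedField_map _, isGalois_fixedField _,
      isCyclic_aut_fixedField _, (finrank_fixedField _).trans hcard⟩
  · intro l hl
    rw [IntermediateField.mem_fixedField_iff] at hl ⊢
    exact fun f hf => hl f (Subgroup.map_mono le_top hf)
  · rw [HopfAction.coe_fixedField_map, ← hgx.adjoin_eq_top]
    ext l
    rw [HopfAction.mem_invariants_adjoin]
    constructor
    · rintro hl z (rfl | hz)
      · exact hxl l (hl g trivial)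
      · rw [hz.counit_eq_one, one_smul]
        exact hl ⟨z, hz⟩ trivial
    · intro hl t _
      rw [hl t.val (Set.mem_insert_of_mem _ t.2), t.2.counit_eq_one, one_smul]
  · rw [HopfAction.coe_fixedField_map]
    ext l
    rw [HopfAction.mem_invariants_adjoin]
    constructor
    · rintro hl z (rfl | rfl)
      · rw [g.2.counit_eq_one, one_smul]
        exact hl g (Subgroup.mem_zpowers g)
      · exact hxl l (hl g (Subgroup.mem_zpowers g))
    · intro hl
      have hg : ρ.groupLikeAut g ∈ MulAction.stabilizer (L ≃ₐ[k] L) l := by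
        have := hl g.val (Set.mem_insert _ _)
        rwa [g.2.counit_eq_one, one_smul] at this
      rw [HopfAction.mem_fixedPoints_iff]
      rintro _ ⟨m, rfl⟩
      have := zpow_mem hg m
      rwa [← map_zpow] at this

end Main

end PointedHopf

theorem theorem4p4 {k : Type u} [Field k] [IsAlgClosed k] [CharZero k]
    {H : Type v} [Ring H] [HopfAlgebra k H] [FiniteDimensional k H]
    (hpointed : IsPointed k H) (hrank : HasRank k H 1) :
    (∃ (g : GroupLike k H) (x : H), IsGeneratingPair k g x) ∧
    ∀ (g : GroupLike k H) (x : H), IsGeneratingPair k g x →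
      (IsGaloisTheoretical.{u, v, w} k H ↔
        ∃ (n : ℕ) (ζ : k), IsTaft (Algebra.adjoin k {g.val, x}) n ζ) ∧
      ∀ (n : ℕ) (ζ : k), IsTaft (Algebra.adjoin k {g.val, x}) n ζ →
        (∀ (L : Type w) [Field L] [Algebra k L] (ρ : HopfAction k H L), ρ.IsInnerFaithful →
          ∃ F E : IntermediateField k L, F ≤ E ∧
            ((F : Set L) = ρ.invariants ⊤ ∧ (F : Set L) = ρ.fixedPoints ⊤ ∧ IsGalois F L) ∧
            ((E : Set L) = ρ.invariants (Algebra.adjoin k {g.val, x}) ∧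
              (E : Set L) = ρ.fixedPoints (Subgroup.zpowers g) ∧
              IsGalois E L ∧ IsCyclic (L ≃ₐ[E] L) ∧ Module.finrank E L = n)) ∧
        (∀ (L : Type w) [Field L] [Algebra k L] (σ : GroupLike k H →* (L ≃ₐ[k] L)),
          Function.Injective σ →
          ∃ ρ : HopfAction k H L, ρ.IsInnerFaithful ∧ ρ.toEnd x ≠ 0 ∧
            ∀ (a : GroupLike k H) (l : L), ρ.toEnd a.val l = σ a l) := by
  refine ⟨?_, fun g x hgx => ⟨⟨?_, ?_⟩, fun n ζ hT => ⟨?_, ?_⟩⟩⟩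
  · obtain ⟨g, x, hx, hxn⟩ := hrank.exists_skewPrimitive hpointed
    exact ⟨g, x, hrank.isGeneratingPair hpointed hx hxn⟩
  · rintro ⟨L, _, _, ρ, hρ⟩
    exact hgx.exists_isTaft hpointed hrank hρ
  · rintro ⟨n, ζ, hT⟩
    have := finite_groupLike (k := k) (C := H)
    obtain ⟨L, _, _, σ, hσ⟩ := exists_field_faithful_action.{u, v, w} k (GroupLike k H)
    obtain ⟨ρ, hρ, -⟩ := hT.exists_hopfAction hpointed hrank hgx σ hσ
    exact ⟨L, inferInstance, inferInstance, ρ, hρ⟩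
  · intro L _ _ ρ hρ
    exact hT.exists_invariants hpointed hrank hgx ρ hρ
  · intro L _ _ σ hσ
    exact hT.exists_hopfAction hpointed hrank hgx σ hσ
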